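/- Let $q$ be a prime power, let $n\ge 4$, $s$, $t$ be integers with $\gcd(s,n)=\gcd(t,n)=1$ and $1\le s,t<n/2$, and let $\theta,\delta\in\mathbb F_{q^n}$ be nonzero elements with $N_{q^n/q}(\theta)\ne 1$ and $N_{q^n/q}(\delta)\ne 1$, where $N_{q^n/q^d}\colon\mathbb F_{q^n}\to\mathbb F_{q^d}$ denotes the field norm for $d\mid n$. Put $f=X^{q^s}+\theta X^{q^{s(n-1)}}$ and $g=X^{q^t}+\delta X^{q^{t(n-1)}}$, and for a polynomial $h\in\mathbb F_{q^n}[X]$ of this form consider the point set $L_h=\{\langle (x,h(x))\rangle_{\mathbb F_{q^n}} : x\in\mathbb F_{q^n}\setminus\{0\}\}$ of the projective line $\mathrm{PG}(1,q^n)$ (a Lunardon–Polverino linear set). Then there is an element of $\mathrm{P\Gamma L}(2,q^n)$ (a permutation of the points of $\mathrm{PG}(1,q^n)$ induced by a bijective semilinear map of $\mathbb F_{q^n}^2$) that maps $L_f$ onto $L_g$ if and only if $s=t$ and one of the following holds: (a) $n$ is odd and $N_{q^n/q}(\theta)\in\{N_{q^n/q}(\delta^\tau),\,N_{q^n/q}(1/\delta^\tau)\}$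 for some field automorphism $\tau\in\mathrm{Aut}(\mathbb F_{q^n})$; (b) $n$ is even and $N_{q^n/q^2}(\theta)\in\{N_{q^n/q^2}(\delta^\tau),\,N_{q^n/q^2}(1/\delta^\tau)\}$ for some field automorphism $\tau\in\mathrm{Aut}(\mathbb F_{q^n})$. -/

import Mathlib

open Polynomial
open scoped LinearAlgebra.Projectivization

namespace LPLinearSet

section ProjectiveLine

variable (K : Type*) [Field K]

/-- The group `PΓL(2, K)` acting on the projective line `PG(1, K)`: the permutations of the points
that are induced by the bijective maps of `K²` which are semilinear with respect to a field
automorphism `τ` of `K`. -/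
def PGammaL : Subgroup (Equiv.Perm (ℙ K (Fin 2 → K))) where
  carrier := {π | ∃ (τ : K ≃+* K) (f : (Fin 2 → K) →ₛₗ[(τ : K →+* K)] (Fin 2 → K))
    (hf : Function.Bijective f), ∀ P, π P = Projectivization.map f hf.injective P}
  one_mem' := by
    let f : (Fin 2 → K) →ₛₗ[((RingEquiv.refl K : K ≃+* K) : K →+* K)] (Fin 2 → K) :=
      { toFun := fun v => v, map_add' := fun _ _ => rfl, map_smul' := fun _ _ => rfl }
    refine ⟨RingEquiv.refl K, f, Function.bijective_id, fun P => ?_⟩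
    induction P using Projectivization.ind with | h v hv => rfl
  mul_mem' := by
    rintro π ρ ⟨τ, f, hf, h⟩ ⟨τ', f', hf', h'⟩
    let g : (Fin 2 → K) →ₛₗ[((τ'.trans τ : K ≃+* K) : K →+* K)] (Fin 2 → K) :=
      { toFun := fun v => f (f' v)
        map_add' := fun _ _ => by simp
        map_smul' := fun c v => by rw [map_smulₛₗ f', map_smulₛₗ f]; rfl }
    refine ⟨τ'.trans τ, g, hf.comp hf', fun P => ?_⟩
    rw [Equiv.Perm.mul_apply, h', h]
    induction P using Projectivization.ind with | h v hv => rfl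
  inv_mem' := by
    rintro π ⟨τ, f, hf, h⟩
    let e := Equiv.ofBijective f hf
    have he : ∀ v, f (e.symm v) = v := e.apply_symm_apply
    let g : (Fin 2 → K) →ₛₗ[((τ.symm : K ≃+* K) : K →+* K)] (Fin 2 → K) :=
      { toFun := fun v => e.symm v
        map_add' := fun v w => hf.injective (by rw [map_add f, he, he, he])
        map_smul' := fun c v => hf.injective (by rw [map_smulₛₗ f, he, he]; simp) }
    refine ⟨τ.symm, g, e.symm.bijective, fun P => ?_⟩
    rw [Equiv.Perm.inv_eq_iff_eq, h]
    induction P using Projectivization.ind with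
    | h v hv =>
      rw [Projectivization.map_mk, Projectivization.map_mk]
      congr 1
      exact (he v).symm

variable {K}

/-- Two point sets of `PG(1, K)` are `PΓL`-equivalent if an element of `PΓL(2, K)` maps the first
onto the second. -/
def PGammaLEquiv (L M : Set (ℙ K (Fin 2 → K))) : Prop :=
  ∃ φ ∈ PGammaL K, φ '' L = M

theorem pair_ne_zero {x : K} (hx : x ≠ 0) (y : K) : ![x, y] ≠ 0 :=
  fun h => hx (by simpa using congrFun h 0)

/-- The point set `L_f = {⟨(x, f(x))⟩ : x ∈ K, x ≠ 0}` of `PG(1, K)`. -/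
def linearSet (f : K[X]) : Set (ℙ K (Fin 2 → K)) :=
  {P | ∃ (x : K) (hx : x ≠ 0), P = Projectivization.mk K ![x, f.eval x] (pair_ne_zero hx _)}

/-- The Lunardon-Polverino polynomial `X^(q^s) + θ X^(q^(s(n-1)))`. -/
noncomputable def lpPoly (q n s : ℕ) (θ : K) : K[X] :=
  X ^ q ^ s + C θ * X ^ q ^ (s * (n - 1))

end ProjectiveLine

section Subfield

variable (F K : Type*) [Field F] [Finite F] [Field K] [Finite K] [Algebra F K]

/-- With `F = 𝔽_q` and `K = 𝔽_(q^n)`, the subfield `{x ∈ K : x^(q^d) = x}` of `K`, which is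
`𝔽_(q^d)` when `d` divides `n`. -/
def subfieldOfDegree (d : ℕ) : IntermediateField F K :=
  have key : ∃ φ : K →ₐ[F] K, ∀ x, φ x = x ^ Nat.card F ^ d := by
    have := Fintype.ofFinite F
    refine ⟨(FiniteField.frobeniusAlgEquivOfAlgebraic F K ^ d : K ≃ₐ[F] K).toAlgHom, fun x => ?_⟩
    change (FiniteField.frobeniusAlgEquivOfAlgebraic F K ^ d) x = _
    rw [AlgEquiv.coe_pow, FiniteField.coe_frobeniusAlgEquivOfAlgebraic_iterate,
      Fintype.card_eq_nat_card]
  { carrier := {x | x ^ Nat.card F ^ d = x}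
    mul_mem' := fun {a b} ha hb => by
      obtain ⟨φ, h⟩ := key
      simp only [Set.mem_ofPred_eq, ← h] at *
      rw [map_mul, ha, hb]
    add_mem' := fun {a b} ha hb => by
      obtain ⟨φ, h⟩ := key
      simp only [Set.mem_ofPred_eq, ← h] at *
      rw [map_add, ha, hb]
    algebraMap_mem' := fun r => by
      obtain ⟨φ, h⟩ := key
      simp only [Set.mem_ofPred_eq, ← h]
      exact φ.commutes r
    inv_mem' := fun a ha => by
      obtain ⟨φ, h⟩ := key
      simp only [Set.mem_ofPred_eq, ← h] at *
      rw [map_inv₀, ha] }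

end Subfield

end LPLinearSet

/-! Encode an `F`-linear map `x ↦ ∑ a g * g x` of `K` by its Dickson matrix `D`. A slope `Y` belongs
to the linear set exactly when `diag(g Y) - D` is singular. The determinant of this matrix is Galois
invariant, so it lies in `F` and its `(q-1)`-th power is the 0/1 indicator of the non-slopes. This
power is a polynomial of degree at most `q-1` in each conjugate of `Y`, and such polynomials are
determined by their values. Hence equal slope sets give equal `(q-1)`-th powers, then equal
polynomials `det (diag(X) - D)`, and so equal principal minors of the Dickson matrices
(`det_diagonal_sub_eq_of_slopes_eq`, `det_submatrix_eq`).

An equivalence of linear sets acts on slopes as a field automorphism followed by a Möbius map. If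
the Möbius map is affine, the 1×1 and 2×2 minors remove the translation and force the two generators
`σ`, `τ` to agree up to inversion; `s + t < n` excludes the inverse. The full determinant then
factors and gives the two norm alternatives (`orbitProd_eq_or_of_slopes_eq`).

Otherwise the target map is replaced, up to an affine change of slope, by the inverse of `m - τ - δ
τ⁻¹`. Its coefficients obey a three-term recursion, while the minors of sizes 2 and 3 prescribe many
zeros. The two requirements conflict when `N(δ) ≠ 1`, unless `n = 4` and `m = 0`
(`card_eq_four_of_inverse`). In that case the inverse is again of Lunardon-Polverino form, with an
inverted and conjugated parameter, and the affine case applies.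

Conversely, Hilbert 90 for `σ²` turns equality of norms into a substitution `x ↦ x / w`
(`exists_smul_slopes_of_orbitProd_eq`), and passing to the adjoint map, which has the same slopes,
accounts for the inverse norm (`slopes_lpCoeff_adjoint`). The relevant norm is the product over
`⟨σ²⟩`: the norm to `𝔽_q` for odd `n`, to `𝔽_(q²)` for even `n`. -/

namespace LPLinearSet

open Matrix

/-! ### Diagonal perturbations of a matrix and its principal minors. -/

section Determinants

variable {ι : Type*} [Fintype ι] [DecidableEq ι] {R : Type*} [CommRing R]

/-- The determinant of `diag(X i) - A`, as a polynomial in the variables `X i`. -/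
noncomputable def multiCharpoly (A : Matrix ι ι R) : MvPolynomial ι R :=
  (diagonal MvPolynomial.X - A.map MvPolynomial.C).det

theorem eval_multiCharpoly (A : Matrix ι ι R) (y : ι → R) :
    MvPolynomial.eval y (multiCharpoly A) = (diagonal y - A).det := by
  rw [multiCharpoly, RingHom.map_det]
  congr 1
  ext i j
  by_cases h : i = j
  · subst h; simp
  · simp [h]

theorem aeval_multiCharpoly (A : Matrix ι ι R) :
    MvPolynomial.aeval (fun _ => (Polynomial.X : R[X])) (multiCharpoly A) = A.charpoly := by
  rw [multiCharpoly, AlgHom.map_det, Matrix.charpoly]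
  congr 1
  ext i j : 1
  by_cases h : i = j
  · subst h; simp [charmatrix]
  · simp [charmatrix, h]

/-- Each variable occurs in a single diagonal entry. Consequently the `(q-1)`-th power is reduced,
with all partial degrees below `q`. -/
theorem degreeOf_multiCharpoly_le [Nontrivial R] (A : Matrix ι ι R) (g : ι) :
    (multiCharpoly A).degreeOf g ≤ 1 := by
  rw [multiCharpoly, det_apply]
  refine (MvPolynomial.degreeOf_sum_le _ _ _).trans (Finset.sup_le fun π _ => ?_)
  have key : (∏ i, (diagonal MvPolynomial.X - A.map MvPolynomial.C :
      Matrix ι ι (MvPolynomial ι R)) (π i) i).degreeOf g ≤ 1 := by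
    refine (MvPolynomial.degreeOf_prod_le _ _ _).trans ?_
    calc _ ≤ ∑ i : ι, if i = g then 1 else 0 := by
          refine Finset.sum_le_sum fun i _ => ?_
          rw [Matrix.sub_apply, Matrix.map_apply]
          refine (MvPolynomial.degreeOf_sub_le _ _ _).trans ?_
          rw [MvPolynomial.degreeOf_C, max_eq_left (Nat.zero_le _)]
          by_cases h : π i = i
          · rw [h, diagonal_apply_eq, MvPolynomial.degreeOf_X]
            by_cases hg : i = g
            · rw [if_pos hg, if_pos hg.symm]
            · rw [if_neg hg, if_neg (Ne.symm hg)]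
          · rw [diagonal_apply_ne _ h]; simp
      _ = 1 := by simp
  rcases Int.units_eq_one_or (Equiv.Perm.sign π) with h | h
  · rwa [h, one_smul]
  · rw [h, Units.neg_smul, one_smul, ← zero_sub]
    refine (MvPolynomial.degreeOf_sub_le _ _ _).trans ?_
    simpa using key

/-- Two polynomials `det (diag(X i) - A)` with equal `(q - 1)`-th powers are equal. -/
theorem multiCharpoly_eq_of_pow_eq {F K : Type*} [Field F] [Finite F] [Field K] [Algebra F K]
    (A B : Matrix ι ι K)
    (h : multiCharpoly A ^ (Nat.card F - 1) = multiCharpoly B ^ (Nat.card F - 1)) :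
    multiCharpoly A = multiCharpoly B := by
  have := Fintype.ofFinite F
  have hq : 1 < Nat.card F := Finite.one_lt_card
  set q := Nat.card F with hqdef
  set P := multiCharpoly A
  set Q := multiCharpoly B
  by_contra hne
  have hR : P - Q ≠ 0 := sub_ne_zero.mpr hne
  have hfrob : (P - Q) ^ q = P ^ q - Q ^ q := by
    have := map_sub (FiniteField.frobeniusAlgHom F (MvPolynomial ι K)) P Q
    rw [FiniteField.coe_frobeniusAlgHom, Fintype.card_eq_nat_card] at this
    exact this
  have hpow : ∀ x : MvPolynomial ι K, x ^ q = x * x ^ (q - 1) := fun x => by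
    rw [← pow_succ', Nat.sub_add_cancel hq.le]
  -- Additivity of `q`-th powers gives `(P - Q)^q = (P - Q) * Q^(q-1)`. After cancelling, set all
  -- variables equal to `X`: the difference of two monic polynomials of equal degree has smaller
  -- degree, which contradicts the equality.
  have h1 : (P - Q) ^ (q - 1) = Q ^ (q - 1) := by
    refine mul_left_cancel₀ hR ?_
    rw [← hpow, hfrob, hpow P, hpow Q, h]; ring
  have h2 := congrArg (MvPolynomial.aeval (fun _ => (Polynomial.X : K[X]))) h1
  rw [map_pow, map_pow, map_sub, aeval_multiCharpoly, aeval_multiCharpoly] at h2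
  have h3 := congrArg Polynomial.natDegree h2
  have hlt : (A.charpoly - B.charpoly).degree < B.charpoly.degree := by
    have e : A.charpoly.degree = B.charpoly.degree := by
      rw [charpoly_degree_eq_dim, charpoly_degree_eq_dim]
    rw [← e]
    exact Polynomial.degree_sub_lt_left e (charpoly_monic A).ne_zero
      (by rw [(charpoly_monic A).leadingCoeff, (charpoly_monic B).leadingCoeff])
  by_cases h0 : A.charpoly - B.charpoly = 0
  · rw [h0, zero_pow (by omega)] at h2
    exact pow_ne_zero _ (charpoly_monic B).ne_zero h2.symm
  · have hB := (charpoly_monic B).ne_zero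
    rw [natDegree_pow, natDegree_pow] at h3
    rw [Polynomial.degree_eq_natDegree h0, Polynomial.degree_eq_natDegree hB] at hlt
    norm_cast at hlt
    have := Nat.eq_of_mul_eq_mul_left (by omega) h3
    omega

/-- Rows of `A` at the indices outside `U`, rows of the identity matrix at the indices in `U`. -/
def replaceRows (A : Matrix ι ι R) (U : Finset ι) : Matrix ι ι R :=
  of fun i j => if i ∈ U then (1 : Matrix ι ι R) i j else A i j

/-- Raising `y a` by one adds the unit vector `e_a` to row `a`, so replacing that row by `e_a` is a
difference of two determinants covered by the hypothesis, which holds for every `y`. -/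
theorem det_replaceRows_eq {A B : Matrix ι ι R}
    (h : ∀ y : ι → R, (diagonal y - A).det = (diagonal y - B).det) (U : Finset ι) (y : ι → R) :
    (replaceRows (diagonal y - A) U).det = (replaceRows (diagonal y - B) U).det := by
  induction U using Finset.induction_on generalizing y with
  | empty =>
    have : ∀ A : Matrix ι ι R, replaceRows A ∅ = A := fun A => by ext; simp [replaceRows]
    rw [this, this, h]
  | insert a U ha ih =>
    have key : ∀ A : Matrix ι ι R, (replaceRows (diagonal y - A) (insert a U)).det =
        (replaceRows (diagonal (Function.update y a (y a + 1)) - A) U).det -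
          (replaceRows (diagonal y - A) U).det := by
      intro A
      have e1 : replaceRows (diagonal y - A) (insert a U) =
          (replaceRows (diagonal y - A) U).updateRow a (fun j => (1 : Matrix ι ι R) a j) := by
        ext i j
        by_cases hi : i = a
        · subst hi; simp [replaceRows]
        · simp [replaceRows, hi]
      have e2 : replaceRows (diagonal (Function.update y a (y a + 1)) - A) U =
          (replaceRows (diagonal y - A) U).updateRow a
            ((fun j => (1 : Matrix ι ι R) a j) + replaceRows (diagonal y - A) U a) := by
        ext i j
        by_cases hi : i = a
        · subst hi
          by_cases hj : j = i
          · subst hj; simp [replaceRows, ha]; ring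
          · simp [replaceRows, ha, diagonal_apply_ne' _ hj, Matrix.one_apply_ne' hj]
        · by_cases hj : i = j
          · subst hj; simp [replaceRows, hi]
          · simp [replaceRows, hi, hj]
      rw [e1, e2, det_updateRow_add, updateRow_eq_self, add_sub_cancel_right]
    rw [key, key, ih, ih]

theorem det_eq_of_equiv {m n : Type*} [Fintype m] [DecidableEq m] [Fintype n] [DecidableEq n]
    (e : m ≃ n) {A : Matrix m m R} {B : Matrix n n R} (h : ∀ i j, A i j = B (e i) (e j)) :
    A.det = B.det := by
  rw [← det_submatrix_equiv_self e B]
  congr 1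
  ext i j
  exact h i j

theorem det_replaceRows (A : Matrix ι ι R) {k : ℕ} (f : Fin k → ι) (hf : Function.Injective f) :
    (replaceRows A (Finset.univ.filter fun i => i ∉ Set.range f)).det
      = (A.submatrix f f).det := by
  classical
  rw [twoBlockTriangular_det (p := fun i => i ∈ Set.range f)]
  · have h1 : (toSquareBlockProp
        (replaceRows A (Finset.univ.filter fun i => i ∉ Set.range f))
        fun i => i ∉ Set.range f) = 1 := by
      ext i j
      have hi : (i : ι) ∈ Finset.univ.filter fun i => i ∉ Set.range f := by simpa using i.2
      simp only [toSquareBlockProp_def, of_apply, replaceRows, if_pos hi]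
      simp [Matrix.one_apply, Subtype.ext_iff]
    have h2 : ∀ M : Matrix {i // i ∉ Set.range f} {i // i ∉ Set.range f} R, M = 1 → M.det = 1 :=
      fun M hM => by rw [hM, det_one]
    rw [h2 _ h1, mul_one]
    let e : Fin k ≃ {i // i ∈ Set.range f} := Equiv.ofInjective f hf
    have h3 := det_eq_of_equiv e (A := A.submatrix f f) (B := toSquareBlockProp
      (replaceRows A (Finset.univ.filter fun i => i ∉ Set.range f)) fun i => i ∈ Set.range f)
      fun i j => by simp [e, replaceRows, toSquareBlockProp]
    rw [h3]
    congr!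
  · intro i hi j hj
    have : j ≠ i := by rintro rfl; exact hi hj
    have hi' : i ∈ Finset.univ.filter fun i => i ∉ Set.range f := by simpa using hi
    rw [replaceRows, of_apply, if_pos hi', Matrix.one_apply_ne' this]

/-- If `det (diag(y) - A)` does not depend on whether `A` or `B` is taken, for all diagonals `y`,
then the principal minors of `A` and `B` agree. -/
theorem det_submatrix_eq {A B : Matrix ι ι R}
    (h : ∀ y : ι → R, (diagonal y - A).det = (diagonal y - B).det) {k : ℕ} (f : Fin k → ι)
    (hf : Function.Injective f) : (A.submatrix f f).det = (B.submatrix f f).det := by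
  have := det_replaceRows_eq h (Finset.univ.filter fun i => i ∉ Set.range f) 0
  rw [det_replaceRows _ f hf, det_replaceRows _ f hf] at this
  have key : ∀ A : Matrix ι ι R,
      ((diagonal 0 - A).submatrix f f).det = (-1) ^ k * (A.submatrix f f).det := by
    intro A
    have : (diagonal 0 - A).submatrix f f = - A.submatrix f f := by ext; simp
    rw [this, det_neg, Fintype.card_fin]
  rw [key, key] at this
  exact ((isUnit_one.neg.pow k).mul_right_inj).mp this

end Determinants

end LPLinearSet

namespace LPLinearSet

open Matrix

/-! ### Dickson matrices of linear maps of `K`. -/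

section Dickson

variable {F K : Type*} [Field F] [Field K] [Algebra F K]

/-- The Dickson matrix of the map `x ↦ ∑ g, a g * g x`. -/
def dicksonMatrix (a : (K ≃ₐ[F] K) → K) : Matrix (K ≃ₐ[F] K) (K ≃ₐ[F] K) K :=
  of fun g k => g (a (g⁻¹ * k))

theorem diagonal_sub_dicksonMatrix [DecidableEq (K ≃ₐ[F] K)] (a : (K ≃ₐ[F] K) → K) (Y : K) :
    diagonal (fun g : K ≃ₐ[F] K => g Y) - dicksonMatrix a =
      dicksonMatrix (Pi.single 1 Y - a) := by
  ext g k
  by_cases h : g = k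
  · subst h; simp [dicksonMatrix]
  · have : g⁻¹ * k ≠ 1 := by rwa [Ne, inv_mul_eq_one]
    simp [dicksonMatrix, h, this]

variable [FiniteDimensional F K]

/-- The `F`-linear map `x ↦ ∑ g, a g * g x` of `K` attached to the coefficients `a`, the sum being
over the automorphisms of `K` over `F`. -/
noncomputable def skewEval (a : (K ≃ₐ[F] K) → K) (x : K) : K := ∑ g, a g * g x

/-- The slopes `Y` of the points `⟨(x, Y x)⟩` of the linear set of `skewEval a`. -/
def slopes (a : (K ≃ₐ[F] K) → K) : Set K := {Y | ∃ x ≠ 0, skewEval a x = Y * x}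

theorem skewEval_add (a : (K ≃ₐ[F] K) → K) (x y : K) :
    skewEval a (x + y) = skewEval a x + skewEval a y := by
  simp [skewEval, mul_add, Finset.sum_add_distrib]

theorem skewEval_smul (a : (K ≃ₐ[F] K) → K) (c : F) (x : K) :
    skewEval a (c • x) = c • skewEval a x := by
  simp [skewEval, Finset.smul_sum]

theorem skewEval_sub_left (a b : (K ≃ₐ[F] K) → K) (x : K) :
    skewEval (a - b) x = skewEval a x - skewEval b x := by
  simp [skewEval, sub_mul]

theorem skewEval_const_mul (c : K) (a : (K ≃ₐ[F] K) → K) (x : K) :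
    skewEval (fun g => c * a g) x = c * skewEval a x := by
  simp [skewEval, Finset.mul_sum, mul_assoc]

theorem eq_zero_of_skewEval_eq_zero {a : (K ≃ₐ[F] K) → K} (h : ∀ x, skewEval a x = 0) : a = 0 := by
  have hli : LinearIndependent K (fun g : K ≃ₐ[F] K => (g : K → K)) :=
    LinearIndependent.comp (ι' := K ≃ₐ[F] K) (linearIndependent_monoidHom K K)
      (fun g => ((g : K →ₐ[F] K) : K →* K)) (fun x y h => by ext z; exact DFunLike.ext_iff.1 h z)
  rw [Fintype.linearIndependent_iff] at hli
  funext g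
  exact hli a (funext fun x => by simpa [skewEval] using h x) g

/-- `skewEval a`, as an `F`-linear map. -/
noncomputable def skewLinear (a : (K ≃ₐ[F] K) → K) : K →ₗ[F] K where
  toFun := skewEval a
  map_add' := skewEval_add a
  map_smul' := skewEval_smul a

theorem dicksonMatrix_mulVec (a : (K ≃ₐ[F] K) → K) (x : K) :
    dicksonMatrix a *ᵥ (fun g => g x) = fun g => g (skewEval a x) := by
  funext g
  simp only [mulVec, dotProduct, dicksonMatrix, of_apply, skewEval, map_sum, map_mul]
  rw [← Equiv.sum_comp (Equiv.mulLeft g)]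
  simp

theorem skewEval_vecMul (c a : (K ≃ₐ[F] K) → K) (x : K) :
    skewEval (c ᵥ* dicksonMatrix a) x = skewEval c (skewEval a x) := by
  have h : ∀ u : (K ≃ₐ[F] K) → K, ∀ y, skewEval u y = u ⬝ᵥ (fun g => g y) := fun u y => rfl
  rw [h, ← dotProduct_mulVec, dicksonMatrix_mulVec, ← h]

variable [DecidableEq (K ≃ₐ[F] K)]

theorem skewEval_single_one (Y x : K) :
    skewEval (Pi.single (1 : K ≃ₐ[F] K) Y) x = Y * x := by
  rw [skewEval, Fintype.sum_eq_single 1]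
  · simp
  · intro g hg; simp [hg]

/-- The conjugates of a kernel element form a right null vector. Conversely, a left null vector `c`
gives `skewEval c ∘ skewEval a = 0`; if `skewEval a` were injective, it would be surjective, and
independence of characters would give `c = 0`. -/
theorem det_dicksonMatrix_eq_zero_iff (a : (K ≃ₐ[F] K) → K) :
    (dicksonMatrix a).det = 0 ↔ ∃ x ≠ 0, skewEval a x = 0 := by
  constructor
  · intro h
    by_contra! hx
    have hinj : Function.Injective (skewLinear a) := by
      rw [injective_iff_map_eq_zero]
      intro x h0
      by_contra hne
      exact hx x hne h0
    have hsurj := LinearMap.injective_iff_surjective.mp hinj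
    obtain ⟨c, hc, hc0⟩ := exists_vecMul_eq_zero_iff.mpr h
    refine hc (eq_zero_of_skewEval_eq_zero fun y => ?_)
    obtain ⟨x, rfl⟩ := hsurj y
    change skewEval c (skewEval a x) = 0
    rw [← skewEval_vecMul, hc0]
    simp [skewEval]
  · rintro ⟨x, hx, h⟩
    rw [← exists_mulVec_eq_zero_iff]
    refine ⟨fun g => g x, fun h0 => hx ?_, ?_⟩
    · simpa using congrFun h0 1
    · rw [dicksonMatrix_mulVec, h]; funext g; simp

/-- A map `skewEval a` with trivial kernel has a left inverse of the same form. -/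
theorem exists_vecMul_dicksonMatrix (a : (K ≃ₐ[F] K) → K) (h : ∀ x ≠ 0, skewEval a x ≠ 0) :
    ∃ c : (K ≃ₐ[F] K) → K, c ᵥ* dicksonMatrix a = Pi.single 1 1 := by
  have hdet : IsUnit (dicksonMatrix a).det := by
    rw [isUnit_iff_ne_zero, Ne, det_dicksonMatrix_eq_zero_iff]
    push Not
    exact h
  refine ⟨Pi.single 1 1 ᵥ* (dicksonMatrix a)⁻¹, ?_⟩
  rw [vecMul_vecMul, nonsing_inv_mul _ hdet, vecMul_one]

/-- Applying `σ` to the entries amounts to reindexing rows and columns by left multiplication by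
`σ`. This places the determinant in `F`. -/
theorem map_det_dicksonMatrix (σ : K ≃ₐ[F] K) (a : (K ≃ₐ[F] K) → K) :
    σ (dicksonMatrix a).det = (dicksonMatrix a).det := by
  rw [AlgEquiv.map_det]
  refine det_eq_of_equiv (Equiv.mulLeft σ) fun g k => ?_
  simp [dicksonMatrix, AlgEquiv.mapMatrix_apply, mul_assoc]

theorem mem_slopes_iff (a : (K ≃ₐ[F] K) → K) (Y : K) :
    Y ∈ slopes a ↔ (diagonal (fun g : K ≃ₐ[F] K => g Y) - dicksonMatrix a).det = 0 := by
  rw [diagonal_sub_dicksonMatrix, det_dicksonMatrix_eq_zero_iff]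
  simp only [skewEval_sub_left, skewEval_single_one, sub_eq_zero, slopes]
  exact exists_congr fun x => and_congr_right fun _ => eq_comm

end Dickson

/-! ### Reduced polynomials, and the invariants shared by maps with equal slopes. -/

section Reduced

variable {F K : Type*} [Field F] [Finite F] [Field K] [Finite K] [Algebra F K]

/-- A polynomial in the variables `X g`, reduced in the sense that its degree in each of them is
less than `q`, is zero if it vanishes at all points `(g Y)` with `Y ∈ K`. -/
theorem eq_zero_of_eval_conjugates (Q : MvPolynomial (K ≃ₐ[F] K) K)
    (hdeg : ∀ g, Q.degreeOf g < Nat.card F)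
    (h : ∀ Y : K, MvPolynomial.eval (fun g : K ≃ₐ[F] K => g Y) Q = 0) : Q = 0 := by
  classical
  have := Fintype.ofFinite F
  have := Fintype.ofFinite K
  set q := Nat.card F with hq
  set n := Module.finrank F K with hn
  let e : Fin n ≃ (K ≃ₐ[F] K) :=
    Equiv.ofBijective _ (FiniteField.bijective_frobeniusAlgEquivOfAlgebraic_pow F K)
  have he : ∀ i x, e i x = x ^ q ^ (i : ℕ) := fun i x => by
    change (FiniteField.frobeniusAlgEquivOfAlgebraic F K ^ (i : ℕ)) x = _
    rw [AlgEquiv.coe_pow, FiniteField.coe_frobeniusAlgEquivOfAlgebraic_iterate,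
      Fintype.card_eq_nat_card]
  -- At the conjugates of `Y` the monomial with exponents `m` becomes `Y ^ E m`, where the exponents
  -- are the base-`q` digits of `E m`. Distinct reduced monomials thus give distinct powers below `q
  -- ^ n`, and a polynomial of degree less than `|K|` vanishing on `K` is zero.
  let E : ((K ≃ₐ[F] K) →₀ ℕ) → ℕ := fun m => ∑ i : Fin n, m (e i) * q ^ (i : ℕ)
  have hm : ∀ m ∈ Q.support, ∀ g, m g < q := fun m hm g =>
    (MvPolynomial.le_degreeOf_of_mem_support g hm).trans_lt (hdeg g)
  have hE : ∀ m (hm' : ∀ g, m g < q),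
      E m = (finFunctionFinEquiv (fun i : Fin n => (⟨m (e i), hm' _⟩ : Fin q)) : ℕ) :=
    fun m hm' => by rw [finFunctionFinEquiv_apply]
  have hElt : ∀ m ∈ Q.support, E m < q ^ n := fun m hms => by
    rw [hE m (hm m hms)]; exact Fin.is_lt _
  have hEinj : ∀ m ∈ Q.support, ∀ m' ∈ Q.support, E m = E m' → m = m' := by
    intro m hms m' hms' heq
    rw [hE m (hm m hms), hE m' (hm m' hms')] at heq
    have := finFunctionFinEquiv.injective (Fin.ext heq)
    ext g
    have := congrArg Fin.val (congrFun this (e.symm g))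
    simpa using this
  let p : K[X] := ∑ m ∈ Q.support, Polynomial.monomial (E m) (Q.coeff m)
  have hpdeg : p.natDegree < Fintype.card K := by
    rw [Fintype.card_eq_nat_card, Module.natCard_eq_pow_finrank (K := F), ← hq, ← hn]
    have hpos : 0 < q ^ n := pow_pos Finite.card_pos _
    refine lt_of_le_of_lt (Polynomial.natDegree_sum_le_of_forall_le (n := q ^ n - 1) _ _
      fun m hms => ?_) (Nat.sub_lt hpos one_pos)
    exact (Polynomial.natDegree_monomial_le _).trans (Nat.le_sub_one_of_lt (hElt m hms))
  have hp : p = 0 := by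
    refine Polynomial.eq_zero_of_natDegree_lt_card_of_eval_eq_zero p Function.injective_id
      (fun Y => ?_) hpdeg
    rw [← h Y, MvPolynomial.eval_eq', Polynomial.eval_finsetSum]
    refine Finset.sum_congr rfl fun m _ => ?_
    rw [Polynomial.eval_monomial, ← e.prod_comp]
    congr 1
    rw [← Finset.prod_pow_eq_pow_sum]
    refine Finset.prod_congr rfl fun i _ => ?_
    rw [he, id, ← pow_mul, mul_comm]
  ext m
  rw [MvPolynomial.coeff_zero]
  by_contra hne
  have hms : m ∈ Q.support := MvPolynomial.mem_support_iff.mpr hne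
  have h0 : p.coeff (E m) = 0 := by rw [hp, Polynomial.coeff_zero]
  rw [Polynomial.finsetSum_coeff, Finset.sum_eq_single_of_mem m hms] at h0
  · rw [Polynomial.coeff_monomial, if_pos rfl] at h0
    exact hne h0
  · intro m' hms' hmm
    rw [Polynomial.coeff_monomial, if_neg fun heq => hmm (hEinj m' hms' m hms heq)]

theorem pow_card_sub_one_of_fixed {x : K} (hx : ∀ g : K ≃ₐ[F] K, g x = x) (h0 : x ≠ 0) :
    x ^ (Nat.card F - 1) = 1 := by
  have := Fintype.ofFinite F
  have h := hx (FiniteField.frobeniusAlgEquivOfAlgebraic F K)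
  rw [FiniteField.coe_frobeniusAlgEquivOfAlgebraic, Fintype.card_eq_nat_card] at h
  have hq : 0 < Nat.card F := Finite.card_pos
  refine mul_left_cancel₀ h0 ?_
  rw [← pow_succ', Nat.sub_add_cancel hq, mul_one]
  exact h

variable [DecidableEq (K ≃ₐ[F] K)]

/-- Linear sets of `PG(1, K)` with the same points have the same Dickson determinants. -/
theorem det_diagonal_sub_eq_of_slopes_eq {a b : (K ≃ₐ[F] K) → K} (h : slopes a = slopes b)
    (y : (K ≃ₐ[F] K) → K) :
    (diagonal y - dicksonMatrix a).det = (diagonal y - dicksonMatrix b).det := by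
  classical
  rw [← eval_multiCharpoly, ← eval_multiCharpoly]
  congr 1
  apply multiCharpoly_eq_of_pow_eq (F := F)
  have hq : 1 < Nat.card F := Finite.one_lt_card
  rw [← sub_eq_zero]
  apply eq_zero_of_eval_conjugates (F := F)
  · intro g
    have key : ∀ A : Matrix (K ≃ₐ[F] K) (K ≃ₐ[F] K) K,
        (multiCharpoly A ^ (Nat.card F - 1)).degreeOf g ≤ Nat.card F - 1 := fun A =>
      (MvPolynomial.degreeOf_pow_le _ _ _).trans
        ((Nat.mul_le_mul_left _ (degreeOf_multiCharpoly_le A g)).trans (by simp))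
    have := (MvPolynomial.degreeOf_sub_le g _ _).trans
      (max_le (key (dicksonMatrix a)) (key (dicksonMatrix b)))
    omega
  · intro Y
    -- The determinant lies in `F`, so its `(q-1)`-th power is 0 on slopes and 1 elsewhere.
    have key : ∀ c : (K ≃ₐ[F] K) → K,
        MvPolynomial.eval (fun g : K ≃ₐ[F] K => g Y)
          (multiCharpoly (dicksonMatrix c) ^ (Nat.card F - 1)) =
        if Y ∈ slopes c then 0 else 1 := by
      intro c
      rw [map_pow, eval_multiCharpoly]
      split_ifs with hY
      · rw [(mem_slopes_iff c Y).mp hY, zero_pow (by omega)]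
      · rw [mem_slopes_iff] at hY
        refine pow_card_sub_one_of_fixed (F := F) (fun g => ?_) hY
        rw [diagonal_sub_dicksonMatrix, map_det_dicksonMatrix]
    rw [map_sub, key, key, h, sub_self]

variable {a b : (K ≃ₐ[F] K) → K}

theorem apply_one_eq_of_slopes_eq (h : slopes a = slopes b) : a 1 = b 1 := by
  have := det_submatrix_eq (det_diagonal_sub_eq_of_slopes_eq h) ![(1 : K ≃ₐ[F] K)]
    (Function.injective_of_subsingleton _)
  rw [det_fin_one, det_fin_one] at this
  simpa [dicksonMatrix] using this

theorem mul_apply_inv_eq_of_slopes_eq (h : slopes a = slopes b) {g : K ≃ₐ[F] K} (hg : g ≠ 1) :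
    a g * g (a g⁻¹) = b g * g (b g⁻¹) := by
  have h1 := apply_one_eq_of_slopes_eq h
  have := det_submatrix_eq (det_diagonal_sub_eq_of_slopes_eq h) ![1, g]
    (by intro i j; fin_cases i <;> fin_cases j <;> simp [hg, hg.symm])
  simp only [det_fin_two, dicksonMatrix, submatrix_apply, of_apply] at this
  simp only [cons_val_zero, cons_val_one, AlgEquiv.one_apply, inv_one, one_mul,
    inv_mul_cancel, mul_one, h1] at this
  exact sub_right_injective this

/-- In the minor on `1, g, k` the diagonal vanishes, so only the two 3-cycles contribute. -/
theorem triangle_eq_of_slopes_eq (h : slopes a = slopes b) (h1 : a 1 = 0) {g k : K ≃ₐ[F] K}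
    (hg : g ≠ 1) (hk : k ≠ 1) (hgk : g ≠ k) :
    a g * g (a (g⁻¹ * k)) * k (a k⁻¹) + a k * g (a g⁻¹) * k (a (k⁻¹ * g)) =
      b g * g (b (g⁻¹ * k)) * k (b k⁻¹) + b k * g (b g⁻¹) * k (b (k⁻¹ * g)) := by
  have h2 := (apply_one_eq_of_slopes_eq h).symm.trans h1
  have := det_submatrix_eq (det_diagonal_sub_eq_of_slopes_eq h) ![1, g, k]
    (by intro i j; fin_cases i <;> fin_cases j <;>
      simp [hg, hg.symm, hk, hk.symm, hgk, hgk.symm])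
  simp only [det_fin_three, dicksonMatrix, submatrix_apply, of_apply] at this
  simp only [cons_val_zero, cons_val_one, cons_val_two, AlgEquiv.one_apply, inv_one, one_mul,
    inv_mul_cancel, mul_one, h1, h2, map_zero, zero_mul, mul_zero] at this
  simp at this
  linear_combination this

theorem det_dicksonMatrix_eq_of_slopes_eq (h : slopes a = slopes b) :
    (dicksonMatrix a).det = (dicksonMatrix b).det := by
  have := det_diagonal_sub_eq_of_slopes_eq h 0
  have key : ∀ A : Matrix (K ≃ₐ[F] K) (K ≃ₐ[F] K) K, diagonal 0 - A = -A := fun A => by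
    ext; simp
  rw [key, key, det_neg, det_neg] at this
  exact ((isUnit_one.neg.pow _).mul_right_inj).mp this

end Reduced

end LPLinearSet

namespace LPLinearSet

open Matrix

/-! ### Determinants of a diagonal plus a cyclic permutation matrix. -/

section Cycle

variable {ι : Type*} [Fintype ι] [DecidableEq ι] {R : Type*} [CommRing R]

/-- If `κ` moves one point along `π`, injectivity forces it to move the next one, and so on around
the cycle. Hence the Leibniz expansion below has only two terms. -/
theorem eq_one_or_eq_of_sameCycle {π κ : Equiv.Perm ι} (hπ : ∀ x y, π.SameCycle x y)
    (hfix : ∀ x, π x ≠ x) (h : ∀ x, κ x = x ∨ κ x = π x) : κ = 1 ∨ κ = π := by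
  by_cases h1 : ∀ x, κ x = x
  · exact Or.inl (Equiv.ext h1)
  · push Not at h1
    obtain ⟨x, hx⟩ := h1
    have key : ∀ k : ℕ, κ ((π ^ k) x) = π ((π ^ k) x) := by
      intro k
      induction k with
      | zero => exact (h x).resolve_left hx
      | succ k ih =>
        rw [pow_succ', Equiv.Perm.mul_apply]
        refine (h _).resolve_left fun h2 => hfix ((π ^ k) x) (κ.injective ?_)
        rw [h2, ih]
    refine Or.inr (Equiv.ext fun y => ?_)
    obtain ⟨k, rfl⟩ := (hπ x y).exists_nat_pow_eq
    exact key k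

/-- The determinant of the sum of a diagonal matrix and the permutation matrix of a cycle. -/
theorem det_diagonal_add_cycle {π : Equiv.Perm ι} (hπ : ∀ x y, π.SameCycle x y)
    (hfix : ∀ x, π x ≠ x) [Nonempty ι] (d : ι → R) :
    (of fun i j => (if j = i then d i else 0) + if j = π i then (1 : R) else 0).det =
      ∏ i, d i + ((Equiv.Perm.sign π : ℤ) : R) := by
  rw [← det_transpose, det_apply']
  rw [Fintype.sum_eq_add (1 : Equiv.Perm ι) π]
  · congr 1
    · rw [Equiv.Perm.sign_one, Units.val_one, Int.cast_one, one_mul]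
      refine Finset.prod_congr rfl fun i _ => ?_
      simp [(hfix i).symm]
    · rw [Finset.prod_eq_one, mul_one]
      intro i _
      simp [hfix i]
  · intro h
    obtain ⟨x⟩ := ‹Nonempty ι›
    exact hfix x (by rw [← h]; rfl)
  · rintro κ ⟨h1, h2⟩
    have : ∃ x, κ x ≠ x ∧ κ x ≠ π x := by
      by_contra! h
      rcases eq_one_or_eq_of_sameCycle hπ hfix fun x => or_iff_not_imp_left.mpr (h x) with h | h
      · exact h1 h
      · exact h2 h
    obtain ⟨x, hx1, hx2⟩ := this
    rw [Finset.prod_eq_zero (Finset.mem_univ x), mul_zero]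
    simp [hx1, hx2]

theorem det_cycle_zpowers {G : Type*} [Group G] [DecidableEq G] {ρ : G} (hρ : ρ ≠ 1) [Fintype (Subgroup.zpowers ρ)]
    (d : Subgroup.zpowers ρ → R) :
    (of fun h k : Subgroup.zpowers ρ => (if k = h then d h else 0) +
      if (k : G) = h * ρ then (1 : R) else 0).det = ∏ h, d h +
        ((Equiv.Perm.sign (Equiv.mulRight (⟨ρ, Subgroup.mem_zpowers ρ⟩ : Subgroup.zpowers ρ)) : ℤ)
          : R) := by
  set ρ' : Subgroup.zpowers ρ := ⟨ρ, Subgroup.mem_zpowers ρ⟩ with hρ'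
  rw [← det_diagonal_add_cycle (π := Equiv.mulRight ρ')]
  · congr 1
    ext h k
    have : k = h * ρ' ↔ (k : G) = h * ρ := Subtype.ext_iff
    simp only [of_apply, Equiv.coe_mulRight, this]
  · rintro ⟨x, i, rfl⟩ ⟨y, j, rfl⟩
    refine ⟨j - i, ?_⟩
    rw [Equiv.zpow_mulRight]
    ext : 1
    simp [hρ', ← _root_.zpow_add]
  · intro x
    simpa [hρ', Subtype.ext_iff] using hρ

end Cycle

/-! ### Norms along cyclic groups of automorphisms, and Hilbert 90. -/

section OrbitProduct

variable {F K : Type*} [Field F] [Field K] [Algebra F K] [FiniteDimensional F K]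

open scoped Classical in
/-- The product of the conjugates of `x` under the cyclic group generated by `ρ`. -/
noncomputable def orbitProd (ρ : K ≃ₐ[F] K) (x : K) : K :=
  ∏ h : Subgroup.zpowers ρ, (h : K ≃ₐ[F] K) x

theorem orbitProd_mul (ρ : K ≃ₐ[F] K) (x y : K) :
    orbitProd ρ (x * y) = orbitProd ρ x * orbitProd ρ y := by
  simp [orbitProd, Finset.prod_mul_distrib]

theorem orbitProd_inv (ρ : K ≃ₐ[F] K) (x : K) : orbitProd ρ x⁻¹ = (orbitProd ρ x)⁻¹ := by
  simp [orbitProd]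

theorem orbitProd_ne_zero (ρ : K ≃ₐ[F] K) {x : K} (hx : x ≠ 0) : orbitProd ρ x ≠ 0 := by
  simp [orbitProd, Finset.prod_ne_zero_iff, hx]

theorem orbitProd_eq_prod_range (ρ : K ≃ₐ[F] K) (x : K) :
    orbitProd ρ x = ∏ i ∈ Finset.range (orderOf ρ), (ρ ^ i) x := by
  classical
  rw [orbitProd, ← (finEquivZPowers (isOfFinOrder_of_finite ρ)).prod_comp,
    Finset.prod_range fun i => (ρ ^ i) x]
  refine Finset.prod_congr rfl fun i _ => ?_
  rw [finEquivZPowers_apply]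

theorem apply_orbitProd_self (ρ : K ≃ₐ[F] K) (x : K) : ρ (orbitProd ρ x) = orbitProd ρ x := by
  classical
  rw [orbitProd, map_prod]
  exact Fintype.prod_equiv (Equiv.mulLeft ⟨ρ, Subgroup.mem_zpowers ρ⟩) _ _ fun h => by simp

theorem orbitProd_apply_self (ρ : K ≃ₐ[F] K) (x : K) : orbitProd ρ (ρ x) = orbitProd ρ x := by
  classical
  rw [orbitProd]
  exact Fintype.prod_equiv (Equiv.mulRight ⟨ρ, Subgroup.mem_zpowers ρ⟩) _ _ fun h => by simp

theorem orbitProd_apply_comm {ρ σ : K ≃ₐ[F] K} (h : Commute ρ σ) (x : K) :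
    orbitProd ρ (σ x) = σ (orbitProd ρ x) := by
  rw [orbitProd_eq_prod_range, orbitProd_eq_prod_range, map_prod]
  refine Finset.prod_congr rfl fun i _ => ?_
  rw [← AlgEquiv.mul_apply, ← AlgEquiv.mul_apply, (h.pow_left i).eq]

theorem orbitProd_eq_prod_of_generator {σ : K ≃ₐ[F] K} (hσ : ∀ g, g ∈ Subgroup.zpowers σ) (x : K) :
    orbitProd σ x = ∏ g : K ≃ₐ[F] K, g x := by
  classical
  rw [orbitProd]
  exact Fintype.prod_equiv (Equiv.subtypeUnivEquiv hσ) _ _ fun h => rfl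

/-- **Hilbert's Theorem 90** for the cyclic group generated by an automorphism `ρ`. -/
theorem exists_mul_apply_eq_of_orbitProd_eq_one {ρ : K ≃ₐ[F] K} {u : K}
    (h : orbitProd ρ u = 1) : ∃ y ≠ 0, u * ρ y = y := by
  -- The witness is the resolvent `∑ b i * (ρ ^ i) z`. The operation `u * ρ(·)` shifts its index by
  -- one, and the sum closes up because `b (orderOf ρ) = 1 = b 0`. Independence of characters
  -- supplies a `z` for which it is nonzero.
  let b : ℕ → K := fun i => ∏ j ∈ Finset.range i, (ρ ^ j) u
  have hb : ∀ i, u * ρ (b i) = b (i + 1) := fun i => by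
    simp only [b, Finset.prod_range_succ', map_prod]
    rw [mul_comm]
    simp [pow_succ']
  have hbm : b (orderOf ρ) = 1 := by rw [← h, orbitProd_eq_prod_range]
  have hli : LinearIndependent K (fun i : Fin (orderOf ρ) => ((ρ ^ (i : ℕ) : K ≃ₐ[F] K) : K → K)) :=
    LinearIndependent.comp (linearIndependent_monoidHom K K)
      (fun i : Fin (orderOf ρ) => (((ρ ^ (i : ℕ) : K ≃ₐ[F] K) : K →ₐ[F] K) : K →* K))
      (fun i j hij => by
        have : ρ ^ (i : ℕ) = ρ ^ (j : ℕ) := by ext z; exact DFunLike.ext_iff.1 hij z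
        exact Fin.ext (pow_injOn_Iio_orderOf i.2 j.2 this))
  obtain ⟨z, hz⟩ : ∃ z, ∑ i ∈ Finset.range (orderOf ρ), b i * (ρ ^ i) z ≠ 0 := by
    by_contra! hz
    rw [Fintype.linearIndependent_iff] at hli
    have := hli (fun i => b i) (funext fun z => by
      have := hz z
      rw [Finset.sum_range] at this
      simpa using this) ⟨0, orderOf_pos ρ⟩
    simp [b] at this
  refine ⟨_, hz, ?_⟩
  rw [map_sum, Finset.mul_sum]
  calc _ = ∑ i ∈ Finset.range (orderOf ρ), b (i + 1) * (ρ ^ (i + 1)) z :=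
        Finset.sum_congr rfl fun i _ => by
          rw [map_mul, ← mul_assoc, hb, pow_succ', AlgEquiv.mul_apply]
    _ = _ := by
      have h1 := Finset.sum_range_succ (fun i => b i * (ρ ^ i) z) (orderOf ρ)
      have h2 := Finset.sum_range_succ' (fun i => b i * (ρ ^ i) z) (orderOf ρ)
      rw [h1, hbm, pow_orderOf_eq_one] at h2
      simpa [b] using h2.symm

end OrbitProduct

/-! ### The Dickson determinant of a Lunardon-Polverino map. -/

section LPDeterminant

variable {F K : Type*} [Field F] [Field K] [Algebra F K] [FiniteDimensional F K]
  [DecidableEq (K ≃ₐ[F] K)]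

/-- The coefficients of the map `x ↦ a * σ x + b * σ⁻¹ x`. -/
def lpCoeff (σ : K ≃ₐ[F] K) (a b : K) : (K ≃ₐ[F] K) → K := Pi.single σ a + Pi.single σ⁻¹ b

theorem skewEval_lpCoeff (σ : K ≃ₐ[F] K) (a b x : K) :
    skewEval (lpCoeff σ a b) x = a * σ x + b * σ⁻¹ x := by
  simp only [skewEval, lpCoeff, Pi.add_apply, add_mul, Finset.sum_add_distrib]
  congr 1
  · rw [Fintype.sum_eq_single σ (fun g hg => by simp [hg]), Pi.single_eq_same]
  · rw [Fintype.sum_eq_single σ⁻¹ (fun g hg => by simp [hg]), Pi.single_eq_same]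

/-- The determinant of the Dickson matrix of `x ↦ ρ x + θ x`. -/
def cycMatrix (ρ : K ≃ₐ[F] K) (θ : K) : Matrix (K ≃ₐ[F] K) (K ≃ₐ[F] K) K :=
  of fun g k => (if k = g then g θ else 0) + if k = g * ρ then 1 else 0

/-- Factor `r σ + r θ σ⁻¹ = r (σ² + θ) σ⁻¹`: composing with `σ⁻¹` permutes columns, and multiplying
by `r` scales row `g` by `g r`. -/
theorem dicksonMatrix_lpCoeff_det (σ : K ≃ₐ[F] K) (r θ : K) :
    ((Equiv.Perm.sign (Equiv.mulRight σ⁻¹) : ℤ) : K) * (dicksonMatrix (lpCoeff σ r (r * θ))).det =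
      (∏ g : K ≃ₐ[F] K, g r) * (cycMatrix (σ * σ) θ).det := by
  rw [← det_permute', ← det_mul_column]
  congr 1
  ext g k
  simp only [submatrix_apply, dicksonMatrix, lpCoeff, cycMatrix, of_apply, Pi.add_apply, map_add,
    Pi.single_apply, id, Equiv.coe_mulRight]
  have e1 : g⁻¹ * (k * σ⁻¹) = σ ↔ k = g * (σ * σ) := by
    rw [inv_mul_eq_iff_eq_mul, mul_inv_eq_iff_eq_mul, mul_assoc]
  have e2 : g⁻¹ * (k * σ⁻¹) = σ⁻¹ ↔ k = g := by
    rw [inv_mul_eq_iff_eq_mul, mul_left_inj]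
  simp only [e1, e2]
  split_ifs <;> simp [add_comm, mul_add]

/-- This is one cycle through the whole group, of odd length and so of sign 1. -/
theorem det_cycMatrix_of_generator {ρ : K ≃ₐ[F] K} (hρ : ρ ≠ 1)
    (hgen : ∀ g, g ∈ Subgroup.zpowers ρ) (hodd : Odd (Fintype.card (K ≃ₐ[F] K))) (θ : K) :
    (cycMatrix ρ θ).det = orbitProd ρ θ + 1 := by
  have hsign : ((Equiv.Perm.sign (Equiv.mulRight ρ) : ℤ) : K) = 1 := by
    have h1 : Equiv.Perm.sign (Equiv.mulRight ρ) ^ Fintype.card (K ≃ₐ[F] K) = 1 := by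
      rw [← map_pow, Equiv.pow_mulRight, pow_card_eq_one, Equiv.mulRight_one]
      exact Equiv.Perm.sign_one
    rcases Int.units_eq_one_or (Equiv.Perm.sign (Equiv.mulRight ρ)) with h | h
    · rw [h]; simp
    · rw [h, hodd.neg_one_pow] at h1
      exact absurd h1 (by decide)
  rw [orbitProd_eq_prod_of_generator hgen, ← hsign, ← det_diagonal_add_cycle (π := Equiv.mulRight ρ)]
  · rfl
  · intro x y
    obtain ⟨i, hi⟩ := hgen (x⁻¹ * y)
    refine ⟨i, ?_⟩
    rw [Equiv.zpow_mulRight]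
    simp only [Equiv.coe_mulRight]
    rw [show ρ ^ i = x⁻¹ * y from hi, mul_inv_cancel_left]
  · intro x
    simpa using hρ

/-- The matrix splits into blocks along the two cosets of `⟨σ²⟩`, each a single cycle; `η` is the
common sign. -/
theorem det_cycMatrix_of_index_two {σ : K ≃ₐ[F] K} (hρ : σ * σ ≠ 1)
    (hσ : σ ∉ Subgroup.zpowers (σ * σ))
    (hgen : ∀ g, g ∈ Subgroup.zpowers (σ * σ) ∨ g * σ⁻¹ ∈ Subgroup.zpowers (σ * σ)) :
    ∃ η : K, η * η = 1 ∧ ∀ θ : K, (cycMatrix (σ * σ) θ).det =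
      (orbitProd (σ * σ) θ + η) * (orbitProd (σ * σ) (σ θ) + η) := by
  classical
  set ρ := σ * σ with hρdef
  set H := Subgroup.zpowers ρ with hH
  refine ⟨((Equiv.Perm.sign (Equiv.mulRight (⟨ρ, Subgroup.mem_zpowers ρ⟩ : H)) : ℤ) : K), ?_, ?_⟩
  · rw [← Int.cast_mul, ← Units.val_mul, Int.units_mul_self]; simp
  · intro θ
    rw [twoBlockTriangular_det (p := fun g => g ∈ H), orbitProd, orbitProd,
      ← det_cycle_zpowers hρ, ← det_cycle_zpowers hρ]
    · congr 1
      · refine det_eq_of_equiv (Equiv.refl _) fun g k => ?_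
        exact congrArg₂ _ (if_congr Subtype.ext_iff.symm rfl rfl) rfl
      · have hmem : ∀ h ∈ H, h * σ ∉ H := fun h hh hc => hσ ((H.mul_mem_cancel_left hh).mp hc)
        let e : H ≃ {g // g ∉ H} :=
          { toFun := fun h => ⟨h * σ, hmem h h.2⟩
            invFun := fun g => ⟨g * σ⁻¹, (hgen g).resolve_left g.2⟩
            left_inv := fun h => by simp
            right_inv := fun g => by simp }
        refine (det_eq_of_equiv e fun g k => ?_).symm
        have : ∀ g k : K ≃ₐ[F] K, k * σ = g * σ * ρ ↔ k = g * ρ := fun g k => by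
          rw [hρdef, ← mul_assoc, ← mul_assoc, mul_left_inj]
        refine congrArg₂ _ (if_congr ?_ rfl rfl) (if_congr (this g k).symm rfl rfl)
        exact Subtype.ext_iff.trans (mul_left_inj σ).symm
    · intro i hi j hj
      have h1 : j ≠ i := by rintro rfl; exact hi hj
      have h2 : j ≠ i * ρ := by
        rintro rfl
        exact hi ((H.mul_mem_cancel_right (Subgroup.mem_zpowers ρ)).mp hj)
      simp [cycMatrix, h1, h2]

end LPDeterminant

end LPLinearSet

namespace LPLinearSet

open Matrix

/-! ### Generators of cyclic groups and their squares. -/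

section Generator

variable {G : Type*} [Group G] {σ : G}

theorem mem_zpowers_mul_self_or (hgen : ∀ g, g ∈ Subgroup.zpowers σ) (g : G) :
    g ∈ Subgroup.zpowers (σ * σ) ∨ g * σ⁻¹ ∈ Subgroup.zpowers (σ * σ) := by
  obtain ⟨i, rfl⟩ := hgen g
  have key : ∀ j : ℤ, σ ^ (2 * j) ∈ Subgroup.zpowers (σ * σ) := fun j =>
    ⟨j, by simp only [← sq]; rw [← zpow_natCast, ← _root_.zpow_mul]; rfl⟩
  rcases Int.even_or_odd' i with ⟨j, rfl | rfl⟩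
  · exact Or.inl (key j)
  · refine Or.inr ?_
    have : (fun x : ℤ => σ ^ x) (2 * j + 1) * σ⁻¹ = σ ^ (2 * j) := by
      simp [_root_.zpow_add]
    rw [this]
    exact key j

theorem odd_card_of_mem_zpowers_mul_self (hgen : ∀ g, g ∈ Subgroup.zpowers σ)
    (h : σ ∈ Subgroup.zpowers (σ * σ)) : Odd (Nat.card G) := by
  obtain ⟨i, hi⟩ := h
  have h1 : σ ^ (2 * i - 1) = 1 := by
    rw [_root_.zpow_sub, zpow_one, mul_inv_eq_one, _root_.zpow_mul, zpow_ofNat, sq]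
    exact hi
  have h2 := orderOf_dvd_iff_zpow_eq_one.mpr h1
  rw [orderOf_eq_card_of_forall_mem_zpowers hgen] at h2
  by_contra hodd
  rw [Nat.not_odd_iff_even] at hodd
  have := (Int.natCast_dvd_natCast.mpr hodd.two_dvd).trans h2
  omega

theorem forall_mem_zpowers_mul_self (hgen : ∀ g, g ∈ Subgroup.zpowers σ)
    (h : σ ∈ Subgroup.zpowers (σ * σ)) (g : G) : g ∈ Subgroup.zpowers (σ * σ) :=
  (Subgroup.zpowers_le.mpr h) (hgen g)

theorem pow_ne_one_of_generator (hgen : ∀ g, g ∈ Subgroup.zpowers σ) {k : ℕ} (hk : k ≠ 0)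
    (hlt : k < Nat.card G) : σ ^ k ≠ 1 :=
  pow_ne_one_of_lt_orderOf hk (by rwa [orderOf_eq_card_of_forall_mem_zpowers hgen])

theorem ne_inv_of_generator (hgen : ∀ g, g ∈ Subgroup.zpowers σ)
    (hcard : 4 ≤ Nat.card G) : σ ≠ σ⁻¹ := by
  rw [Ne, ← mul_eq_one_iff_eq_inv, ← sq]
  exact pow_ne_one_of_generator hgen two_ne_zero (by omega)

end Generator

/-! ### Norm conditions for proportional linear sets with the same automorphism. -/

section SameDirection

variable {F K : Type*} [Field F] [Field K] [Algebra F K]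

theorem prod_eq_orbitProd_mul [FiniteDimensional F K] {σ : K ≃ₐ[F] K} (hgen : ∀ g, g ∈ Subgroup.zpowers σ)
    (hσ : σ ∉ Subgroup.zpowers (σ * σ)) (x : K) :
    ∏ g : K ≃ₐ[F] K, g x = orbitProd (σ * σ) x * orbitProd (σ * σ) (σ x) := by
  classical
  have h2 := mem_zpowers_mul_self_or hgen
  set H := Subgroup.zpowers (σ * σ) with hH
  have hmem : ∀ h ∈ H, h * σ ∉ H := fun h hh hc => hσ ((H.mul_mem_cancel_left hh).mp hc)
  let e : H ≃ {g // g ∉ H} :=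
    { toFun := fun h => ⟨h * σ, hmem h h.2⟩
      invFun := fun g => ⟨g * σ⁻¹, (h2 g).resolve_left g.2⟩
      left_inv := fun h => by simp
      right_inv := fun g => by simp }
  rw [← Fintype.prod_subtype_mul_prod_subtype (fun g => g ∈ H)]
  congr 1
  exact (Fintype.prod_equiv e _ _ fun h => by simp [e]).symm

variable [DecidableEq (K ≃ₐ[F] K)]

theorem lpCoeff_apply_self {σ : K ≃ₐ[F] K} (h : σ ≠ σ⁻¹) (a b : K) : lpCoeff σ a b σ = a := by
  simp [lpCoeff, h]

theorem lpCoeff_apply_inv {σ : K ≃ₐ[F] K} (h : σ ≠ σ⁻¹) (a b : K) : lpCoeff σ a b σ⁻¹ = b := by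
  simp [lpCoeff, h.symm]

theorem lpCoeff_apply_of_ne {σ g : K ≃ₐ[F] K} (h : g ≠ σ) (h' : g ≠ σ⁻¹) (a b : K) :
    lpCoeff σ a b g = 0 := by
  simp [lpCoeff, h, h']

/-- Two Lunardon-Polverino linear sets with the same automorphism `σ` that agree up to a scaling
have norms that agree up to inversion and conjugation. -/
theorem orbitProd_eq_or_of_slopes_eq [Finite F] [Finite K] {σ : K ≃ₐ[F] K} (hgen : ∀ g, g ∈ Subgroup.zpowers σ)
    (hcard : 4 ≤ Nat.card (K ≃ₐ[F] K)) {θ δ r : K}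
    (h : slopes (lpCoeff σ 1 θ) = slopes (lpCoeff σ r (r * δ))) :
    orbitProd (σ * σ) θ = orbitProd (σ * σ) δ ∨
      orbitProd (σ * σ) θ * σ (orbitProd (σ * σ) δ) = 1 := by
  have hinv := ne_inv_of_generator hgen hcard
  have hσ1 : σ ≠ 1 := by
    simpa using pow_ne_one_of_generator hgen one_ne_zero (by omega)
  have hσ2 : σ * σ ≠ 1 := by rwa [Ne, mul_eq_one_iff_eq_inv]
  have hθ : θ = σ⁻¹ r * r * δ := by
    have := mul_apply_inv_eq_of_slopes_eq h hσ1
    rw [lpCoeff_apply_self hinv, lpCoeff_apply_inv hinv, lpCoeff_apply_self hinv,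
      lpCoeff_apply_inv hinv, one_mul] at this
    apply σ.injective
    rw [this, map_mul, map_mul, map_mul, ← AlgEquiv.mul_apply, mul_inv_cancel, AlgEquiv.one_apply]
    ring
  have hdet : (cycMatrix (σ * σ) θ).det =
      (∏ g : K ≃ₐ[F] K, g r) * (cycMatrix (σ * σ) δ).det := by
    rw [← dicksonMatrix_lpCoeff_det, ← det_dicksonMatrix_eq_of_slopes_eq h]
    have := dicksonMatrix_lpCoeff_det σ 1 θ
    simp only [map_one, Finset.prod_const_one, one_mul] at this
    exact this.symm
  have hinvr : orbitProd (σ * σ) (σ⁻¹ r) = orbitProd (σ * σ) (σ r) := by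
    rw [← orbitProd_apply_self (σ * σ) (σ⁻¹ r)]
    congr 1
    rw [← AlgEquiv.mul_apply, mul_assoc, mul_inv_cancel, mul_one]
  have hcomm : Commute (σ * σ) σ := (Commute.refl σ).mul_left (Commute.refl σ)
  have hA : orbitProd (σ * σ) θ =
      σ (orbitProd (σ * σ) r) * orbitProd (σ * σ) r * orbitProd (σ * σ) δ := by
    rw [hθ, orbitProd_mul, orbitProd_mul, hinvr, orbitProd_apply_comm hcomm]
  by_cases hmem : σ ∈ Subgroup.zpowers (σ * σ)
  · have hgen2 := forall_mem_zpowers_mul_self hgen hmem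
    have hodd := odd_card_of_mem_zpowers_mul_self hgen hmem
    rw [Nat.card_eq_fintype_card] at hodd
    have hfix : ∀ x, σ (orbitProd (σ * σ) x) = orbitProd (σ * σ) x := fun x => by
      rw [orbitProd_eq_prod_of_generator hgen2, ← orbitProd_eq_prod_of_generator hgen,
        apply_orbitProd_self]
    rw [det_cycMatrix_of_generator hσ2 hgen2 hodd, det_cycMatrix_of_generator hσ2 hgen2 hodd,
      ← orbitProd_eq_prod_of_generator hgen2, hA, hfix] at hdet
    rw [hA, hfix, hfix]
    -- With `N` the norm, `N θ = N r ^ 2 * N δ` and `N θ + 1 = N r * (N δ + 1)`; eliminating `N θ`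
    -- factors.
    have h0 : (orbitProd (σ * σ) r - 1) * (orbitProd (σ * σ) r * orbitProd (σ * σ) δ - 1) = 0 := by
      linear_combination hdet
    rcases mul_eq_zero.mp h0 with h1 | h1
    · left; rw [sub_eq_zero.mp h1]; ring
    · right
      have h1 := sub_eq_zero.mp h1
      linear_combination (orbitProd (σ * σ) r * orbitProd (σ * σ) δ + 1) * h1
  · obtain ⟨η, hη, hform⟩ := det_cycMatrix_of_index_two hσ2 hmem (mem_zpowers_mul_self_or hgen)
    have hfix : σ (σ (orbitProd (σ * σ) r)) = orbitProd (σ * σ) r :=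
      apply_orbitProd_self (σ * σ) r
    rw [hform, hform, prod_eq_orbitProd_mul hgen hmem] at hdet
    simp only [orbitProd_apply_comm hcomm] at hdet
    rw [hA, map_mul, map_mul, hfix] at hdet
    rw [hA]
    set a := orbitProd (σ * σ) r
    set b := orbitProd (σ * σ) δ
    -- The terms linear in `η` cancel between the two sides, so only `η * η = 1` matters and the
    -- sign need not be known.
    have h0 : (σ a * a - 1) * (σ a * a * b * σ b - 1) = 0 := by
      linear_combination hdet + (a * σ a - 1) * hη
    rcases mul_eq_zero.mp h0 with h1 | h1
    · left; rw [sub_eq_zero.mp h1]; ring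
    · right; linear_combination h1

end SameDirection

/-! ### The recursion satisfied by the coefficients of an inverse map. -/

section InverseMap

variable {F K : Type*} [Field F] [Field K] [Algebra F K]

theorem dicksonMatrix_add (a b : (K ≃ₐ[F] K) → K) :
    dicksonMatrix (a + b) = dicksonMatrix a + dicksonMatrix b := by
  ext; simp [dicksonMatrix]

theorem dicksonMatrix_sub (a b : (K ≃ₐ[F] K) → K) :
    dicksonMatrix (a - b) = dicksonMatrix a - dicksonMatrix b := by
  ext; simp [dicksonMatrix]

variable [FiniteDimensional F K] [DecidableEq (K ≃ₐ[F] K)]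

theorem vecMul_dicksonMatrix_single (c : (K ≃ₐ[F] K) → K) (x : K ≃ₐ[F] K) (v : K)
    (k : K ≃ₐ[F] K) :
    (c ᵥ* dicksonMatrix (Pi.single x v)) k = c (k * x⁻¹) * (k * x⁻¹) v := by
  simp only [vecMul, dotProduct, dicksonMatrix, of_apply]
  rw [Fintype.sum_eq_single (k * x⁻¹)]
  · simp
  · intro g hg
    have : g⁻¹ * k ≠ x := by
      rintro rfl
      simp at hg
    simp [this]

theorem vecMul_dicksonMatrix_single_sub_lpCoeff (c : (K ≃ₐ[F] K) → K) (τ : K ≃ₐ[F] K) (m δ : K)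
    (k : K ≃ₐ[F] K) :
    (c ᵥ* dicksonMatrix (Pi.single 1 m - lpCoeff τ 1 δ)) k =
      c k * k m - c (k * τ⁻¹) - c (k * τ) * (k * τ) δ := by
  rw [dicksonMatrix_sub, lpCoeff, dicksonMatrix_add, vecMul_sub, vecMul_add, Pi.sub_apply,
    Pi.add_apply, vecMul_dicksonMatrix_single, vecMul_dicksonMatrix_single,
    vecMul_dicksonMatrix_single]
  simp
  ring

end InverseMap

section Recursion

variable {F K : Type*} [Field F] [Field K] [Algebra F K] [FiniteDimensional F K]

/-- No two consecutive coefficients of the inverse of `m - (τ + δ τ⁻¹)` vanish. -/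
theorem apply_mul_ne_zero {τ : K ≃ₐ[F] K} (hgen : ∀ g, g ∈ Subgroup.zpowers τ) {m δ : K}
    (hδ : δ ≠ 0) {c : (K ≃ₐ[F] K) → K}
    (hR : ∀ g, g ≠ 1 → c g * g m = c (g * τ⁻¹) + c (g * τ) * (g * τ) δ) (hc : ∃ g, c g ≠ 0)
    {g : K ≃ₐ[F] K} (hg : c g = 0) : c (g * τ) ≠ 0 := by
  intro hg'
  set n := Nat.card (K ≃ₐ[F] K) with hn
  have hord : orderOf τ = n := orderOf_eq_card_of_forall_mem_zpowers hgen
  have hpow : ∀ g : K ≃ₐ[F] K, ∃ j < n, τ ^ j = g := fun g => by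
    have := (mem_powers_iff_mem_zpowers (x := τ)).mpr (hgen g)
    obtain ⟨j, hj⟩ := (Submonoid.mem_powers_iff _ _).mp this
    exact ⟨j % n, Nat.mod_lt _ Nat.card_pos, by rw [← hord, pow_mod_orderOf, hj]⟩
  have hrec : ∀ j, j + 1 < n →
      c (τ ^ (j + 1)) * (τ ^ (j + 1)) m = c (τ ^ j) + c (τ ^ (j + 2)) * (τ ^ (j + 2)) δ :=
    fun j hj => by
      have := hR (τ ^ (j + 1)) (pow_ne_one_of_generator hgen (by omega) hj)
      rwa [← pow_succ, pow_succ τ j, mul_inv_cancel_right] at this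
  obtain ⟨j, hj, rfl⟩ := hpow g
  rw [← pow_succ] at hg'
  -- Two consecutive zeros spread upwards to exponent `n - 1` and downwards to 0. The recursion is
  -- never applied at `g = 1`, where it may fail, yet all of the group is reached.
  have hup : ∀ i, j + i < n → c (τ ^ (j + i)) = 0 ∧ c (τ ^ (j + i + 1)) = 0 := by
    intro i
    induction i with
    | zero => exact fun _ => ⟨hg, hg'⟩
    | succ i ih =>
      intro hi
      obtain ⟨h1, h2⟩ := ih (by omega)
      refine ⟨h2, ?_⟩
      have := hrec (j + i) (by omega)
      rw [h1, h2, zero_mul, zero_add] at this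
      exact (mul_eq_zero.mp this.symm).resolve_right ((_root_.map_ne_zero _).mpr hδ)
  have hdown : ∀ i ≤ j, c (τ ^ (j - i)) = 0 ∧ c (τ ^ (j - i + 1)) = 0 := by
    intro i
    induction i with
    | zero => exact fun _ => ⟨hg, hg'⟩
    | succ i ih =>
      intro hi
      obtain ⟨h1, h2⟩ := ih (by omega)
      have e : j - i = j - (i + 1) + 1 := by omega
      rw [e] at h1 h2
      refine ⟨?_, h1⟩
      have := hrec (j - (i + 1)) (by omega)
      rw [h1, h2, zero_mul, zero_mul, add_zero] at this
      exact this.symm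
  obtain ⟨g, hg⟩ := hc
  obtain ⟨k, hk, rfl⟩ := hpow g
  rcases le_total k j with hkj | hkj
  · have := (hdown (j - k) (by omega)).1
    rw [Nat.sub_sub_self hkj] at this
    exact hg this
  · have := (hup (k - j) (by omega)).1
    rw [Nat.add_sub_cancel' hkj] at this
    exact hg this

end Recursion

end LPLinearSet

namespace LPLinearSet

open scoped Matrix

theorem zpow_ne_zpow_of_generator {G : Type*} [Group G] {τ : G}
    (hgen : ∀ g, g ∈ Subgroup.zpowers τ) {i j : ℤ} (hij : i ≠ j)
    (hlt : |i - j| < Nat.card G) : τ ^ i ≠ τ ^ j := by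
  intro h
  have h1 : τ ^ (i - j) = 1 := by rw [_root_.zpow_sub, h, mul_inv_cancel]
  have h2 := orderOf_dvd_iff_zpow_eq_one.mpr h1
  rw [orderOf_eq_card_of_forall_mem_zpowers hgen] at h2
  exact hij (sub_eq_zero.mp (Int.eq_zero_of_abs_lt_dvd h2 hlt))

/-- A product of two elements of `{σ, σ⁻¹}` is in that set only if `σ = 1` or `σ ^ 3 = 1`. This
kills every 3-cycle term of a Lunardon-Polverino map. -/
theorem not_mul_of_eq_or_eq_inv {G : Type*} [Group G] {σ : G}
    (hgen : ∀ g, g ∈ Subgroup.zpowers σ) (hcard : 4 ≤ Nat.card G) {g k : G}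
    (hg : g = σ ∨ g = σ⁻¹) (hk : k = σ ∨ k = σ⁻¹) (hgk : g * k = σ ∨ g * k = σ⁻¹) : False := by
  have h1 : σ ≠ 1 := by simpa using pow_ne_one_of_generator hgen one_ne_zero (by omega)
  have h3 : σ ^ 3 ≠ 1 := pow_ne_one_of_generator hgen three_ne_zero (by omega)
  rw [pow_succ, sq] at h3
  rcases hg with rfl | rfl <;> rcases hk with rfl | rfl <;> rcases hgk with h | h
  · exact h1 (by simpa using h)
  · exact h3 (by rw [h, inv_mul_cancel])
  · exact h1 (by simpa using h.symm)
  · exact h1 (by simpa using h.symm)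
  · exact h1 (by simpa using h.symm)
  · exact h1 (by simpa using h.symm)
  · exact h3 (by rw [mul_eq_one_iff_inv_eq, mul_inv_rev, h])
  · exact h1 (by simpa using h)

theorem eq_or_eq_inv_of_lpCoeff_ne_zero {F K : Type*} [Field F] [Field K] [Algebra F K]
    [DecidableEq (K ≃ₐ[F] K)] {σ g : K ≃ₐ[F] K} {a b : K} (h : lpCoeff σ a b g ≠ 0) :
    g = σ ∨ g = σ⁻¹ := by
  by_contra! h'
  exact h (lpCoeff_apply_of_ne h'.1 h'.2 a b)

/-! ### Zero patterns of the inverse, and the exceptional degree four. -/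

section Recursion

variable {F K : Type*} [Field F] [Field K] [Algebra F K] [FiniteDimensional F K]

/-- The coefficients `c` of the inverse of `x ↦ m x - τ x - δ τ⁻¹ x` cannot have the zero pattern
of a Lunardon-Polverino polynomial (up to the coefficient of `x`), unless the degree is four and
`m = 0`. -/
theorem card_eq_four_of_inverse {σ τ : K ≃ₐ[F] K} (hσ : ∀ g, g ∈ Subgroup.zpowers σ)
    (hτ : ∀ g, g ∈ Subgroup.zpowers τ) (hcard : 4 ≤ Nat.card (K ≃ₐ[F] K)) {m δ : K}
    (hδ : δ ≠ 0) (hN : ∏ g : K ≃ₐ[F] K, g δ ≠ 1) {c : (K ≃ₐ[F] K) → K}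
    (hR : ∀ g, g ≠ 1 → c g * g m = c (g * τ⁻¹) + c (g * τ) * (g * τ) δ)
    (hc : c σ ≠ 0) (hS2 : ∀ g, g ≠ 1 → g ≠ σ → g ≠ σ⁻¹ → c g = 0 ∨ c g⁻¹ = 0)
    (hS3 : ∀ g k, g ≠ 1 → k ≠ 1 → g * k ≠ 1 → c g = 0 ∨ c k = 0 ∨ c (g * k)⁻¹ = 0) :
    Nat.card (K ≃ₐ[F] K) = 4 ∧ m = 0 ∧ c (τ ^ (2 : ℤ)) = 0 := by
  set n := Nat.card (K ≃ₐ[F] K) with hn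
  have hord : orderOf τ = n := orderOf_eq_card_of_forall_mem_zpowers hτ
  have hτn : τ ^ (n : ℤ) = 1 := by rw [zpow_natCast, ← hord, pow_orderOf_eq_one]
  have hne : ∀ i j : ℤ, i ≠ j → |i - j| < n → τ ^ i ≠ τ ^ j := fun i j =>
    zpow_ne_zpow_of_generator hτ
  have hne1 : ∀ i : ℤ, i ≠ 0 → |i| < n → τ ^ i ≠ 1 := fun i hi hlt => by
    have := hne i 0 hi (by simpa using hlt)
    rwa [zpow_zero] at this
  have hcomp : ∀ (i j : ℤ) (x : K), (τ ^ i) ((τ ^ j) x) = (τ ^ (i + j)) x := fun i j x => by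
    rw [_root_.zpow_add, AlgEquiv.mul_apply]
  have hn4 : (4 : ℤ) ≤ n := by exact_mod_cast hcard
  have adj : ∀ j : ℤ, c (τ ^ j) = 0 → c (τ ^ (j + 1)) ≠ 0 := fun j hj => by
    rw [zpow_add_one]
    exact apply_mul_ne_zero hτ hδ hR ⟨σ, hc⟩ hj
  have adj' : ∀ j : ℤ, c (τ ^ (j + 1)) = 0 → c (τ ^ j) ≠ 0 := fun j hj hj' => adj j hj' hj
  have S2 : ∀ j : ℤ, τ ^ j ≠ 1 → τ ^ j ≠ σ → τ ^ j ≠ σ⁻¹ → c (τ ^ j) = 0 ∨ c (τ ^ (-j)) = 0 :=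
    fun j => by rw [zpow_neg]; exact hS2 _
  have S3 : ∀ i : ℤ, τ ^ i ≠ 1 → τ ^ (2 * i) ≠ 1 → c (τ ^ i) ≠ 0 → c (τ ^ (-(2 * i))) = 0 := by
    intro i h1 h2 h3
    have e : τ ^ i * τ ^ i = τ ^ (2 * i) := by rw [← _root_.zpow_add]; congr 1; ring
    have := hS3 _ _ h1 h1 (by rwa [e])
    rw [e, ← zpow_neg] at this
    tauto
  have R : ∀ j : ℤ, τ ^ j ≠ 1 →
      c (τ ^ j) * (τ ^ j) m = c (τ ^ (j - 1)) + c (τ ^ (j + 1)) * (τ ^ (j + 1)) δ := fun j hj => by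
    rw [zpow_sub_one, zpow_add_one]
    exact hR _ hj
  have hσ2 : σ * σ ≠ 1 := by
    rw [← sq]; exact pow_ne_one_of_generator hσ two_ne_zero (by omega)
  have a1 := hne1 1 (by norm_num) (by norm_num; omega)
  have a2 := hne1 2 (by norm_num) (by norm_num; omega)
  have a3 := hne1 3 (by norm_num) (by norm_num; omega)
  have am1 := hne1 (-1) (by norm_num) (by norm_num; omega)
  have am2 := hne1 (-2) (by norm_num) (by norm_num; omega)
  have am3 := hne1 (-3) (by norm_num) (by norm_num; omega)
  -- Write `c_j` for `c (τ ^ j)`. If `c_1 = 0`, then `c_(-1) = 0` and `c_2`, `c_(-2)` are nonzero,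
  -- so `τ ^ 2` is `σ` or `σ⁻¹`. If `c_1 ≠ 0`, then `c_2 = c_(-2) = 0`, `c_(-1) ≠ 0`, and `τ` itself
  -- is `σ` or `σ⁻¹`.
  by_cases h1 : c (τ ^ (1 : ℤ)) = 0
  · exfalso
    have c2 : c (τ ^ (2 : ℤ)) ≠ 0 := adj 1 h1
    have hm1 : c (τ ^ (-1 : ℤ)) = 0 := by
      by_contra hm1
      exact c2 (S3 (-1) am1 am2 hm1)
    have cm2 : c (τ ^ (-2 : ℤ)) ≠ 0 := adj' (-2) hm1
    have hσ' : τ ^ (2 : ℤ) = σ ∨ τ ^ (-2 : ℤ) = σ := by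
      by_contra! h
      rcases S2 2 a2 h.1 (fun h' => h.2 (by rw [zpow_neg, h', inv_inv])) with h' | h'
      · exact c2 h'
      · exact cm2 h'
    by_cases hn4' : n = 4
    · have h4 : τ ^ (4 : ℤ) = 1 := by rw [← hτn, hn4']; rfl
      rcases hσ' with h | h
      · apply hσ2
        rw [← h, ← _root_.zpow_add]; exact h4
      · apply hσ2
        rw [← h, ← _root_.zpow_add, show (-2 + -2 : ℤ) = -4 by norm_num, zpow_neg, h4, inv_one]
    · have hn5 : (5 : ℤ) ≤ n := by omega
      have a4 := hne1 4 (by norm_num) (by norm_num; omega)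
      have am4 := hne1 (-4) (by norm_num) (by norm_num; omega)
      have cm4 : c (τ ^ (-4 : ℤ)) = 0 := S3 2 a2 a4 c2
      have c4 : c (τ ^ (4 : ℤ)) = 0 := S3 (-2) am2 am4 cm2
      by_cases hn5' : n = 5
      -- For `n = 5` only `c_0`, `c_2`, `c_3` survive. The recursion at `±2` gives `δ = m * τ⁴ m`,
      -- at `±1` it then gives `N(m) = 1`, hence `N(δ) = N(m)² = 1`.
      · have h5 : ∀ j : ℤ, τ ^ (j + 5) = τ ^ j := fun j => by
          rw [_root_.zpow_add, show (5 : ℤ) = ((5 : ℕ) : ℤ) from rfl, ← hn5', hτn, mul_one]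
        have r2 := R 2 a2
        have rm2 := R (-2) am2
        have r1 := R 1 a1
        have rm1 := R (-1) am1
        have e3 : τ ^ (3 : ℤ) = τ ^ (-2 : ℤ) := by simpa using h5 (-2)
        have em3 : τ ^ (-3 : ℤ) = τ ^ (2 : ℤ) := by simpa using (h5 (-3)).symm
        have e4 : τ ^ (-1 : ℤ) = τ ^ (4 : ℤ) := by simpa using (h5 (-1)).symm
        have e6 : τ ^ (6 : ℤ) = τ ^ (1 : ℤ) := by simpa using h5 1
        norm_num only at r2 rm2 r1 rm1
        rw [h1, e3, zero_add] at r2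
        rw [hm1, em3, zero_mul, add_zero] at rm2
        rw [h1, zero_mul, zpow_zero] at r1
        rw [hm1, zero_mul, zpow_zero, AlgEquiv.one_apply] at rm1
        have hd : (τ ^ (-2 : ℤ)) δ = (τ ^ (-2 : ℤ)) m * (τ ^ (2 : ℤ)) m := by
          refine mul_left_cancel₀ cm2 ?_
          rw [← r2, ← rm2]; ring
        have hd0 : δ = m * (τ ^ (4 : ℤ)) m := by
          have := congrArg (τ ^ (2 : ℤ)) hd
          rw [map_mul, hcomp, hcomp, hcomp] at this
          simpa using this
        have hd2 : (τ ^ (2 : ℤ)) δ = (τ ^ (2 : ℤ)) m * (τ ^ (1 : ℤ)) m := by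
          have := congrArg (τ ^ (2 : ℤ)) hd0
          rw [map_mul, hcomp] at this
          norm_num only at this
          rw [this, e6]
        have h0 : c 1 ≠ 0 := fun h0 => by
          rw [h0, zero_mul, add_zero] at rm1
          exact cm2 rm1.symm
        have hprod : δ * (τ ^ (3 : ℤ)) m * (τ ^ (2 : ℤ)) δ = 1 := by
          refine mul_left_cancel₀ h0 ?_
          rw [e3]
          linear_combination r1 - (τ ^ (2 : ℤ)) δ * rm2 - (τ ^ (-2 : ℤ)) m * (τ ^ (2 : ℤ)) δ * rm1
        have hNm : ∏ g : K ≃ₐ[F] K, g m = 1 := by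
          rw [← orbitProd_eq_prod_of_generator hτ, orbitProd_eq_prod_range, hord, hn5',
            ← hprod, hd2, hd0]
          simp only [Finset.prod_range_succ, Finset.prod_range_zero, ← zpow_natCast]
          norm_num only
          rw [zpow_zero, AlgEquiv.one_apply]
          ring
        apply hN
        rw [hd0]
        simp only [map_mul, Finset.prod_mul_distrib]
        rw [Fintype.prod_equiv (Equiv.mulRight (τ ^ (4 : ℤ))) (fun g => g ((τ ^ (4 : ℤ)) m))
          (fun g => g m) fun g => rfl, hNm, one_mul]
      -- For `n ≥ 6` both `c_3` and `c_(-3)` are nonzero, so `τ ^ 3` would also be `σ` or `σ⁻¹`,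
      -- that is `τ ^ 2` or `τ ^ (-2)`.
      · have a5 := hne 3 (-2) (by norm_num) (by norm_num; omega)
        have a5' := hne 3 2 (by norm_num) (by norm_num; omega)
        have c3 : c (τ ^ (3 : ℤ)) ≠ 0 := adj' 3 c4
        have cm3 : c (τ ^ (-3 : ℤ)) ≠ 0 := adj (-4) cm4
        have : τ ^ (3 : ℤ) ≠ σ ∧ τ ^ (3 : ℤ) ≠ σ⁻¹ := by
          rcases hσ' with h | h
          · rw [← h, ← zpow_neg]; exact ⟨a5', a5⟩
          · rw [← h, ← zpow_neg, neg_neg]; exact ⟨a5, a5'⟩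
        rcases S2 3 a3 this.1 this.2 with h | h
        · exact c3 h
        · exact cm3 h
  · have hm2 : c (τ ^ (-2 : ℤ)) = 0 := S3 1 a1 a2 h1
    have hm1 : c (τ ^ (-1 : ℤ)) ≠ 0 := adj (-2) hm2
    have h2 : c (τ ^ (2 : ℤ)) = 0 := S3 (-1) am1 am2 hm1
    have hσ' : τ ^ (1 : ℤ) = σ ∨ τ ^ (-1 : ℤ) = σ := by
      by_contra! h
      rcases S2 1 a1 h.1 (fun h' => h.2 (by rw [zpow_neg, h', inv_inv])) with h' | h'
      · exact h1 h'
      · exact hm1 h'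
    by_cases hn4' : n = 4
    · refine ⟨hn4', ?_, h2⟩
      by_contra hm
      have h4 : ∀ j : ℤ, τ ^ (j + 4) = τ ^ j := fun j => by
        rw [_root_.zpow_add, show (4 : ℤ) = ((4 : ℕ) : ℤ) from rfl, ← hn4', hτn, mul_one]
      have r2 := R 2 a2
      have r1 := R 1 a1
      have rm1 := R (-1) am1
      norm_num only at r2 rm1 r1
      have e3 : τ ^ (-1 : ℤ) = τ ^ (3 : ℤ) := by simpa using (h4 (-1)).symm
      have e5 : τ ^ (5 : ℤ) = τ ^ (1 : ℤ) := by simpa using h4 1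
      rw [h2, zero_mul, ← e3] at r2
      rw [h2, zero_mul, add_zero, zpow_zero] at r1
      rw [hm2, zero_add, zpow_zero, AlgEquiv.one_apply] at rm1
      -- Eliminating the coefficients relates `τ⁻¹ m` to `τ m`. Combined with its image under `τ²`,
      -- this reads `τ⁻¹ m = N(δ) * τ⁻¹ m`, so `m ≠ 0` would force `N(δ) = 1`.
      have hd : (τ ^ (-1 : ℤ)) m = -((τ ^ (-1 : ℤ)) δ * δ * (τ ^ (1 : ℤ)) m) := by
        refine mul_left_cancel₀ hm1 ?_
        linear_combination rm1 - δ * r1 - δ * (τ ^ (1 : ℤ)) m * r2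
      have hd2 : (τ ^ (1 : ℤ)) m =
          -((τ ^ (1 : ℤ)) δ * (τ ^ (2 : ℤ)) δ * (τ ^ (-1 : ℤ)) m) := by
        have := congrArg (τ ^ (2 : ℤ)) hd
        rw [map_neg, map_mul, map_mul, hcomp, hcomp, hcomp] at this
        norm_num only at this
        rw [this, e3]
      apply hN
      refine mul_right_cancel₀ (b := (τ ^ (-1 : ℤ)) m) ((_root_.map_ne_zero _).mpr hm) ?_
      rw [← orbitProd_eq_prod_of_generator hτ, orbitProd_eq_prod_range, hord, hn4']
      simp only [Finset.prod_range_succ, Finset.prod_range_zero, ← zpow_natCast]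
      norm_num only
      rw [zpow_zero, AlgEquiv.one_apply, ← e3]
      linear_combination -hd + (τ ^ (-1 : ℤ)) δ * δ * hd2
    · exfalso
      have hn5 : (5 : ℤ) ≤ n := by omega
      have c3 : c (τ ^ (3 : ℤ)) ≠ 0 := adj 2 h2
      have cm3 : c (τ ^ (-3 : ℤ)) ≠ 0 := adj' (-3) hm2
      have b1 := hne 3 1 (by norm_num) (by norm_num; omega)
      have b2 := hne 3 (-1) (by norm_num) (by norm_num; omega)
      have : τ ^ (3 : ℤ) ≠ σ ∧ τ ^ (3 : ℤ) ≠ σ⁻¹ := by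
        rcases hσ' with h | h
        · rw [← h, ← zpow_neg]; exact ⟨b1, b2⟩
        · rw [← h, ← zpow_neg, neg_neg]; exact ⟨b2, b1⟩
      rcases S2 3 a3 this.1 this.2 with h | h
      · exact c3 h
      · exact cm3 h

end Recursion

/-! ### Comparing a Lunardon-Polverino map with an inverse map. -/

section InverseSlopes

variable {F K : Type*} [Field F] [Finite F] [Field K] [Finite K] [Algebra F K]
  [DecidableEq (K ≃ₐ[F] K)]

/-- A Lunardon-Polverino linear set with automorphism `σ` is, up to an affine map of the slopes, the
linear set of the inverse of `x ↦ m x - τ x - δ τ⁻¹ x` only if `σ = τ` and the norms agree up to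
inversion and conjugation. -/
theorem orbitProd_eq_or_of_slopes_eq_inverse {σ τ : K ≃ₐ[F] K}
    (hσ : ∀ g, g ∈ Subgroup.zpowers σ) (hτ : ∀ g, g ∈ Subgroup.zpowers τ)
    (hcard : 4 ≤ Nat.card (K ≃ₐ[F] K)) (h4 : Nat.card (K ≃ₐ[F] K) = 4 → σ = τ)
    {θ δ m α β : K} (hθ : θ ≠ 0) (hδ : δ ≠ 0) (hN : ∏ g : K ≃ₐ[F] K, g δ ≠ 1) (hβ : β ≠ 0)
    {c : (K ≃ₐ[F] K) → K}
    (hc : c ᵥ* dicksonMatrix (Pi.single 1 m - lpCoeff τ 1 δ) = Pi.single 1 1)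
    (h : slopes (lpCoeff σ 1 θ) = slopes (Pi.single 1 α + fun g => β * c g)) :
    σ = τ ∧ (orbitProd (σ * σ) θ = orbitProd (σ * σ) δ ∨
      orbitProd (σ * σ) θ * σ (orbitProd (σ * σ) δ) = 1) := by
  have hinv := ne_inv_of_generator hσ hcard
  have hσ1 : σ ≠ 1 := by simpa using pow_ne_one_of_generator hσ one_ne_zero (by omega)
  set b : (K ≃ₐ[F] K) → K := Pi.single 1 α + fun g => β * c g with hb
  have hbg : ∀ g, g ≠ 1 → b g = β * c g := fun g hg => by simp [hb, hg]
  have hlp1 : lpCoeff σ 1 θ 1 = 0 :=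
    lpCoeff_apply_of_ne hσ1.symm (by simpa [eq_comm] using hσ1) 1 θ
  have hb1 : b 1 = 0 := (apply_one_eq_of_slopes_eq h).symm.trans hlp1
  have hR : ∀ g, g ≠ 1 → c g * g m = c (g * τ⁻¹) + c (g * τ) * (g * τ) δ := fun g hg => by
    have := congrFun hc g
    rw [vecMul_dicksonMatrix_single_sub_lpCoeff, Pi.single_eq_of_ne hg] at this
    linear_combination this
  have hmul : ∀ g, g ≠ 1 → lpCoeff σ 1 θ g * g (lpCoeff σ 1 θ g⁻¹) =
      (β * g β) * (c g * g (c g⁻¹)) := fun g hg => by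
    rw [mul_apply_inv_eq_of_slopes_eq h hg, hbg g hg, hbg g⁻¹ (by simpa using hg), map_mul]
    ring
  have hββ : ∀ g : K ≃ₐ[F] K, β * g β ≠ 0 := fun g => mul_ne_zero hβ (by simpa using hβ)
  have hS2 : ∀ g, g ≠ 1 → g ≠ σ → g ≠ σ⁻¹ → c g = 0 ∨ c g⁻¹ = 0 := fun g h1 h2 h3 => by
    have := hmul g h1
    rw [lpCoeff_apply_of_ne h2 h3, zero_mul] at this
    rcases mul_eq_zero.mp ((mul_eq_zero.mp this.symm).resolve_left (hββ g)) with h' | h'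
    · exact Or.inl h'
    · exact Or.inr (by simpa using h')
  have hcσ : c σ ≠ 0 := fun h0 => by
    have := hmul σ hσ1
    rw [lpCoeff_apply_self hinv, lpCoeff_apply_inv hinv, h0, zero_mul, mul_zero, one_mul] at this
    exact hθ (by simpa using this)
  have hS2' : ∀ g, g ≠ 1 → c g ≠ 0 → c g⁻¹ ≠ 0 → g = σ ∨ g = σ⁻¹ := fun g h1 h2 h3 => by
    by_contra! h'
    rcases hS2 g h1 h'.1 h'.2 with h0 | h0
    · exact h2 h0
    · exact h3 h0
  have hS3 : ∀ g k, g ≠ 1 → k ≠ 1 → g * k ≠ 1 → c g = 0 ∨ c k = 0 ∨ c (g * k)⁻¹ = 0 := by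
    intro g k hg hk hgk
    by_contra! hne
    have htri := triangle_eq_of_slopes_eq h hlp1 hg hgk (by simpa using hk)
    rw [inv_mul_cancel_left, show (g * k)⁻¹ * g = k⁻¹ by group] at htri
    have hl1 : lpCoeff σ 1 θ g * g (lpCoeff σ 1 θ k) * (g * k) (lpCoeff σ 1 θ (g * k)⁻¹) = 0 := by
      by_contra h0
      simp only [mul_eq_zero, EmbeddingLike.map_eq_zero_iff, not_or] at h0
      refine not_mul_of_eq_or_eq_inv hσ hcard (eq_or_eq_inv_of_lpCoeff_ne_zero h0.1.1)
        (eq_or_eq_inv_of_lpCoeff_ne_zero h0.1.2) ?_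
      have := eq_or_eq_inv_of_lpCoeff_ne_zero h0.2
      rwa [inv_inj, inv_eq_iff_eq_inv, or_comm] at this
    have hl2 : lpCoeff σ 1 θ (g * k) * g (lpCoeff σ 1 θ g⁻¹) *
        (g * k) (lpCoeff σ 1 θ k⁻¹) = 0 := by
      by_contra h0
      simp only [mul_eq_zero, EmbeddingLike.map_eq_zero_iff, not_or] at h0
      have e1 := eq_or_eq_inv_of_lpCoeff_ne_zero h0.1.2
      have e2 := eq_or_eq_inv_of_lpCoeff_ne_zero h0.2
      rw [inv_inj, inv_eq_iff_eq_inv, or_comm] at e1 e2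
      exact not_mul_of_eq_or_eq_inv hσ hcard e1 e2 (eq_or_eq_inv_of_lpCoeff_ne_zero h0.1.1)
    have hg' : g⁻¹ ≠ 1 := by simpa using hg
    have hk' : k⁻¹ ≠ 1 := by simpa using hk
    have hgk' : (g * k)⁻¹ ≠ 1 := by rwa [Ne, inv_eq_one]
    rw [hl1, hl2, hbg g hg, hbg k hk, hbg _ hgk, hbg _ hgk', hbg _ hg', hbg _ hk'] at htri
    have hfirst : β * c g * g (β * c k) * (g * k) (β * c (g * k)⁻¹) ≠ 0 := by
      simp only [ne_eq, mul_eq_zero, EmbeddingLike.map_eq_zero_iff, not_or]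
      exact ⟨⟨⟨hβ, hne.1⟩, hβ, hne.2.1⟩, hβ, hne.2.2⟩
    -- The two 3-cycle terms of `b` sum to zero, so if one is nonzero, so is the other. Then `c` is
    -- nonzero at `g`, `k`, `g * k` and their inverses, which puts all three in `{σ, σ⁻¹}`.
    have hsecond : β * c (g * k) * g (β * c g⁻¹) * (g * k) (β * c k⁻¹) ≠ 0 := fun h0 => by
      rw [h0] at htri
      exact hfirst (by linear_combination -htri)
    simp only [ne_eq, mul_eq_zero, EmbeddingLike.map_eq_zero_iff, not_or] at hsecond
    exact not_mul_of_eq_or_eq_inv hσ hcard (hS2' g hg hne.1 hsecond.1.2.2)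
      (hS2' k hk hne.2.1 hsecond.2.2) (hS2' _ hgk hsecond.1.1.2 hne.2.2)
  obtain ⟨hn4, hm, hc2⟩ := card_eq_four_of_inverse hσ hτ hcard hδ hN hR hcσ hS2 hS3
  obtain rfl := h4 hn4
  refine ⟨rfl, ?_⟩
  rw [zpow_ofNat] at hc2
  have hord : orderOf σ = 4 := by rw [orderOf_eq_card_of_forall_mem_zpowers hσ, hn4]
  have hσ2 : σ ^ 2 ≠ 1 := pow_ne_one_of_generator hσ two_ne_zero (by omega)
  have hσ3 : σ ^ 3 = σ⁻¹ := by
    rw [eq_inv_iff_mul_eq_one, ← pow_succ, show 3 + 1 = orderOf σ from hord.symm,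
      pow_orderOf_eq_one]
  have hrel : c σ = -(c σ⁻¹ * σ⁻¹ δ) := by
    have := hR _ hσ2
    rw [hc2, sq, mul_inv_cancel_right, ← sq, ← pow_succ, hσ3] at this
    linear_combination -this
  -- In degree four, `b` vanishes at `1` and `σ ^ 2`, and the recursion at `σ ^ 2` fixes the ratio
  -- of the two other coefficients. Thus `b` is a Lunardon-Polverino map with parameter `-(σ⁻¹
  -- δ)⁻¹`, and the affine case applies.
  have hbform : b = lpCoeff σ (b σ) (b σ * -(σ⁻¹ δ)⁻¹) := by
    have hδ' : σ⁻¹ δ ≠ 0 := by simpa using hδ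
    have e : b σ * -(σ⁻¹ δ)⁻¹ = b σ⁻¹ := by
      rw [hbg _ hσ1, hbg σ⁻¹ (by simpa using hσ1), hrel]
      field_simp
    rw [e]
    funext g
    obtain ⟨j, hj⟩ := (Submonoid.mem_powers_iff _ _).mp
      ((mem_powers_iff_mem_zpowers (x := σ)).mpr (hσ g))
    rw [← pow_mod_orderOf, hord] at hj
    have hlt : j % 4 < 4 := Nat.mod_lt _ (by norm_num)
    subst hj
    interval_cases j % 4
    · rw [pow_zero, hb1, lpCoeff_apply_of_ne hσ1.symm (by simpa [eq_comm] using hσ1)]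
    · rw [pow_one, lpCoeff_apply_self hinv]
    · rw [hbg _ hσ2, hc2, mul_zero, lpCoeff_apply_of_ne]
      · rw [sq]; simpa using hσ1
      · rw [← hσ3, pow_succ σ 2]; simpa using hσ1
    · rw [hσ3, lpCoeff_apply_inv hinv]
  rw [hbform] at h
  have hneg : orbitProd (σ * σ) (-1 : K) = 1 := by
    have : orderOf (σ * σ) = 2 := by
      rw [← sq, orderOf_pow, hord]; rfl
    rw [orbitProd_eq_prod_range, this]
    simp
  have hcomm : Commute (σ * σ) σ⁻¹ := ((Commute.refl σ).mul_left (Commute.refl σ)).inv_right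
  have hconj : orbitProd (σ * σ) (-(σ⁻¹ δ)⁻¹) = (σ (orbitProd (σ * σ) δ))⁻¹ := by
    rw [← neg_one_mul, orbitProd_mul, hneg, one_mul, orbitProd_inv, orbitProd_apply_comm hcomm]
    congr 1
    conv_lhs => rw [← apply_orbitProd_self]
    rw [← AlgEquiv.mul_apply, inv_mul_cancel_left]
  have hne : σ (orbitProd (σ * σ) δ) ≠ 0 := by simpa using orbitProd_ne_zero (σ * σ) hδ
  rcases orbitProd_eq_or_of_slopes_eq hσ hcard h with h' | h'
  · right
    rw [h', hconj, inv_mul_cancel₀ hne]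
  · left
    rw [hconj, map_inv₀, ← AlgEquiv.mul_apply, apply_orbitProd_self] at h'
    exact (mul_inv_eq_one₀ (orbitProd_ne_zero _ hδ)).mp h'

end InverseSlopes

end LPLinearSet

namespace LPLinearSet

open scoped Matrix

/-! ### Möbius maps, scalings, adjoints and field automorphisms acting on slopes. -/

section Slopes

theorem skewLinear_apply {F K : Type*} [Field F] [Field K] [Algebra F K] [FiniteDimensional F K]
    (a : (K ≃ₐ[F] K) → K) (x : K) : skewLinear a x = skewEval a x := rfl

variable {F K : Type*} [Field F] [Field K] [Algebra F K] [FiniteDimensional F K]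
  [DecidableEq (K ≃ₐ[F] K)]

theorem mem_slopes_affine {α β : K} (hβ : β ≠ 0) (c : (K ≃ₐ[F] K) → K) (Y : K) :
    Y ∈ slopes (Pi.single 1 α + fun g => β * c g) ↔ (Y - α) / β ∈ slopes c := by
  have h : ∀ x, skewEval (Pi.single 1 α + fun g => β * c g) x = α * x + β * skewEval c x := by
    intro x
    rw [← skewEval_single_one (F := F), ← skewEval_const_mul]
    simp [skewEval, add_mul, Finset.sum_add_distrib]
  refine exists_congr fun x => and_congr_right fun _ => ?_
  rw [h, div_mul_eq_mul_div, eq_div_iff hβ]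
  constructor
  · intro h; linear_combination h
  · intro h; linear_combination h

theorem skewEval_single_one_sub (a : (K ≃ₐ[F] K) → K) (m x : K) :
    skewEval (Pi.single 1 m - a) x = m * x - skewEval a x := by
  rw [skewEval_sub_left, skewEval_single_one]

/-- The slopes of the inverse of `x ↦ m x - a x`. -/
theorem mem_slopes_inverse {a c : (K ≃ₐ[F] K) → K} {m : K}
    (hm : m ∉ slopes a) (hc : c ᵥ* dicksonMatrix (Pi.single 1 m - a) = Pi.single 1 1) (Y : K) :
    Y ∈ slopes c ↔ Y ≠ 0 ∧ m - Y⁻¹ ∈ slopes a := by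
  have hinv : ∀ x, skewEval c (m * x - skewEval a x) = x := fun x => by
    rw [← skewEval_single_one_sub, ← skewEval_vecMul, hc, skewEval_single_one, one_mul]
  have hsurj : Function.Surjective (skewLinear (Pi.single 1 m - a)) := by
    rw [← LinearMap.injective_iff_surjective]
    intro x y hxy
    rw [skewLinear_apply, skewLinear_apply, skewEval_single_one_sub, skewEval_single_one_sub] at hxy
    rw [← hinv x, ← hinv y, hxy]
  constructor
  · rintro ⟨z, hz, hY⟩
    obtain ⟨x, rfl⟩ := hsurj z
    rw [skewLinear_apply, skewEval_single_one_sub] at hY hz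
    rw [hinv] at hY
    have hx : x ≠ 0 := by
      rintro rfl
      apply hz
      simp [skewEval]
    have hY0 : Y ≠ 0 := by rintro rfl; exact hx (by rw [hY, zero_mul])
    refine ⟨hY0, x, hx, ?_⟩
    field_simp
    linear_combination hY
  · rintro ⟨hY0, x, hx, hY⟩
    refine ⟨m * x - skewEval a x, fun h0 => hm ⟨x, hx, by linear_combination -h0⟩, ?_⟩
    rw [hinv, hY]
    field_simp
    ring

/-- If a projectivity maps one Lunardon-Polverino linear set onto another, the defining
automorphisms agree and so do the norms, up to inversion and conjugation. -/
theorem orbitProd_eq_or_of_mobius [Finite F] [Finite K] {σ τ : K ≃ₐ[F] K}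
    (hσ : ∀ g, g ∈ Subgroup.zpowers σ) (hτ : ∀ g, g ∈ Subgroup.zpowers τ)
    (hcard : 4 ≤ Nat.card (K ≃ₐ[F] K)) (h4 : Nat.card (K ≃ₐ[F] K) = 4 → σ = τ)
    (hστ : σ ≠ τ⁻¹) {θ δ a b c d : K} (hθ : θ ≠ 0) (hδ : δ ≠ 0)
    (hN : ∏ g : K ≃ₐ[F] K, g δ ≠ 1) (hdet : a * d - b * c ≠ 0)
    (hb : b ≠ 0 → d / b ∉ slopes (lpCoeff τ 1 δ))
    (hU : ∀ u, u ∈ slopes (lpCoeff σ 1 θ) ↔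
      a + b * u ≠ 0 ∧ (c + d * u) / (a + b * u) ∈ slopes (lpCoeff τ 1 δ)) :
    σ = τ ∧ (orbitProd (σ * σ) θ = orbitProd (σ * σ) δ ∨
      orbitProd (σ * σ) θ * σ (orbitProd (σ * σ) δ) = 1) := by
  by_cases hb0 : b = 0
  · subst hb0
    have ha : a ≠ 0 := by rintro rfl; simp at hdet
    have hd : d ≠ 0 := by rintro rfl; simp at hdet
    have h : slopes (lpCoeff σ 1 θ) =
        slopes (Pi.single 1 (-(c / d)) + fun g => (a / d) * lpCoeff τ 1 δ g) := by
      ext u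
      rw [hU, mem_slopes_affine (div_ne_zero ha hd), zero_mul, add_zero]
      have : (u - -(c / d)) / (a / d) = (c + d * u) / a := by field_simp; ring
      rw [this]
      exact and_iff_right ha
    have hσ1 : σ ≠ 1 := by simpa using pow_ne_one_of_generator hσ one_ne_zero (by omega)
    have hτ1 : τ ≠ 1 := by simpa using pow_ne_one_of_generator hτ one_ne_zero (by omega)
    have h1 := apply_one_eq_of_slopes_eq h
    rw [lpCoeff_apply_of_ne hσ1.symm (by simpa [eq_comm] using hσ1), Pi.add_apply,
      lpCoeff_apply_of_ne hτ1.symm (by simpa [eq_comm] using hτ1), Pi.single_eq_same, mul_zero,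
      add_zero] at h1
    have hform : (Pi.single 1 (-(c / d)) + fun g => (a / d) * lpCoeff τ 1 δ g) =
        lpCoeff τ (a / d) (a / d * δ) := by
      rw [← h1]
      funext g
      simp only [lpCoeff, Pi.add_apply, Pi.single_apply]
      split_ifs <;> simp [mul_add]
    rw [hform] at h
    have hinv := ne_inv_of_generator hσ hcard
    have h2 := mul_apply_inv_eq_of_slopes_eq h hσ1
    rw [lpCoeff_apply_self hinv, lpCoeff_apply_inv hinv, one_mul] at h2
    have h3 : lpCoeff τ (a / d) (a / d * δ) σ ≠ 0 := fun h0 => by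
      rw [h0, zero_mul] at h2
      exact hθ (by simpa using h2)
    obtain rfl := (eq_or_eq_inv_of_lpCoeff_ne_zero h3).resolve_right hστ
    exact ⟨rfl, orbitProd_eq_or_of_slopes_eq hσ hcard h⟩
  · have hm := hb hb0
    obtain ⟨e, he⟩ := exists_vecMul_dicksonMatrix (Pi.single 1 (d / b) - lpCoeff τ 1 δ)
      fun x hx h0 => hm ⟨x, hx, by
        rw [skewEval_single_one_sub] at h0
        linear_combination -h0⟩
    -- With `m = d / b`, the value `(c + d u) / (a + b u)` equals `m - Y⁻¹` for `Y = b (a + b u) /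
    -- (a d - b c)`. So `Y` is a slope of the inverse map, and `u = -(a / b) + (a d - b c) / b² *
    -- Y`.
    have hβ : (a * d - b * c) / b ^ 2 ≠ 0 := div_ne_zero hdet (pow_ne_zero 2 hb0)
    refine orbitProd_eq_or_of_slopes_eq_inverse hσ hτ hcard h4 hθ hδ hN hβ he
      (α := -(a / b)) ?_
    ext u
    rw [hU, mem_slopes_affine hβ, mem_slopes_inverse hm he]
    have e1 : (u - -(a / b)) / ((a * d - b * c) / b ^ 2) =
        b * (a + b * u) / (a * d - b * c) := by
      field_simp
      ring
    rw [e1]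
    by_cases h0 : a + b * u = 0
    · simp [h0]
    · have e2 : d / b - (b * (a + b * u) / (a * d - b * c))⁻¹ = (c + d * u) / (a + b * u) := by
        field_simp
        ring
      rw [e2]
      exact and_congr_left fun _ => iff_of_true h0 (div_ne_zero (mul_ne_zero hb0 h0) hdet)

/-- Substituting `x / w` for `x` in a Lunardon-Polverino polynomial. -/
theorem mem_slopes_lpCoeff_scale (σ : K ≃ₐ[F] K) (θ : K) {w : K} (hw : w ≠ 0) (Y : K) :
    Y ∈ slopes (lpCoeff σ 1 θ) ↔
      Y * (w / σ w) ∈ slopes (lpCoeff σ 1 (θ * (σ⁻¹ w / σ w))) := by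
  have hσw : σ w ≠ 0 := by simpa using hw
  have hσw' : σ⁻¹ w ≠ 0 := by simpa using hw
  constructor
  · rintro ⟨x, hx, h⟩
    refine ⟨x / w, div_ne_zero hx hw, ?_⟩
    rw [skewEval_lpCoeff] at h ⊢
    rw [map_div₀, map_div₀]
    field_simp
    linear_combination h
  · rintro ⟨x, hx, h⟩
    refine ⟨x * w, mul_ne_zero hx hw, ?_⟩
    rw [skewEval_lpCoeff] at h ⊢
    rw [map_mul, map_mul]
    field_simp at h
    linear_combination h

/-- Transposing the Dickson matrix gives that of the adjoint for the trace form and leaves the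
diagonal in `Y` unchanged. This is where the inverted norm comes from. -/
theorem slopes_lpCoeff_adjoint (σ : K ≃ₐ[F] K) (θ : K) :
    slopes (lpCoeff σ 1 θ) = slopes (lpCoeff σ (σ θ) 1) := by
  ext Y
  rw [mem_slopes_iff, mem_slopes_iff, ← Matrix.det_transpose]
  have : (Matrix.diagonal (fun g : K ≃ₐ[F] K => g Y) - dicksonMatrix (lpCoeff σ 1 θ))ᵀ =
      Matrix.diagonal (fun g : K ≃ₐ[F] K => g Y) - dicksonMatrix (lpCoeff σ (σ θ) 1) := by
    rw [Matrix.transpose_sub, Matrix.diagonal_transpose]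
    congr 1
    ext g k
    have e1 : k⁻¹ * g = σ ↔ g⁻¹ * k = σ⁻¹ := by
      rw [← inv_inj, mul_inv_rev, inv_inv]
    have e2 : k⁻¹ * g = σ⁻¹ ↔ g⁻¹ * k = σ := by
      rw [← inv_inj, mul_inv_rev, inv_inv, inv_inv]
    simp only [Matrix.transpose_apply, dicksonMatrix, Matrix.of_apply, lpCoeff, Pi.add_apply,
      Pi.single_apply, map_add, e1, e2]
    rw [add_comm]
    congr 1
    · split_ifs with h
      · rw [← h, ← AlgEquiv.mul_apply, mul_inv_cancel_left]
      · simp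
    · split_ifs <;> simp
  rw [this]

theorem mem_slopes_lpCoeff_map (σ : K ≃ₐ[F] K) (τ : K ≃+* K) (h : ∀ x, τ (σ x) = σ (τ x))
    (θ Y : K) : τ Y ∈ slopes (lpCoeff σ 1 (τ θ)) ↔ Y ∈ slopes (lpCoeff σ 1 θ) := by
  have h' : ∀ x, τ (σ⁻¹ x) = σ⁻¹ (τ x) := fun x => by
    apply σ.injective
    rw [← h]
    change τ ((σ * σ⁻¹) x) = (σ * σ⁻¹) (τ x)
    simp
  constructor
  · rintro ⟨x, hx, hY⟩
    refine ⟨τ.symm x, by simpa using hx, τ.injective ?_⟩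
    rw [skewEval_lpCoeff] at hY ⊢
    simpa only [map_add, map_mul, map_one, h, h', RingEquiv.apply_symm_apply] using hY
  · rintro ⟨x, hx, hY⟩
    refine ⟨τ x, by simpa using hx, ?_⟩
    rw [skewEval_lpCoeff] at hY ⊢
    have := congrArg τ hY
    simpa only [map_add, map_mul, map_one, h, h'] using this

theorem mem_slopes_lpCoeff_const_mul (σ : K ≃ₐ[F] K) {r : K} (hr : r ≠ 0) (a b Y : K) :
    Y ∈ slopes (lpCoeff σ a b) ↔ r * Y ∈ slopes (lpCoeff σ (r * a) (r * b)) := by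
  refine exists_congr fun x => and_congr_right fun _ => ?_
  rw [skewEval_lpCoeff, skewEval_lpCoeff]
  constructor
  · intro h; linear_combination r * h
  · intro h
    refine mul_left_cancel₀ hr ?_
    linear_combination h

/-- Lunardon-Polverino linear sets whose norms agree are proportional. -/
theorem exists_smul_slopes_of_orbitProd_eq {σ : K ≃ₐ[F] K} {θ δ : K} (hθ : θ ≠ 0)
    (h : orbitProd (σ * σ) θ = orbitProd (σ * σ) δ) :
    ∃ r ≠ 0, ∀ Y, Y ∈ slopes (lpCoeff σ 1 θ) ↔ Y * r ∈ slopes (lpCoeff σ 1 δ) := by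
  obtain ⟨y, hy, hu⟩ := exists_mul_apply_eq_of_orbitProd_eq_one (ρ := σ * σ) (u := δ / θ) (by
    rw [div_eq_mul_inv, orbitProd_mul, orbitProd_inv, h,
      mul_inv_cancel₀ (h ▸ orbitProd_ne_zero _ hθ)])
  have hw : σ y ≠ 0 := by simpa using hy
  refine ⟨σ y / σ (σ y), div_ne_zero hw (by simpa using hy), fun Y => ?_⟩
  rw [mem_slopes_lpCoeff_scale σ θ hw]
  have e1 : σ⁻¹ (σ y) = y := by rw [← AlgEquiv.mul_apply, inv_mul_cancel, AlgEquiv.one_apply]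
  have hw2 : σ (σ y) ≠ 0 := by simpa using hy
  have e2 : θ * (σ⁻¹ (σ y) / σ (σ y)) = δ := by
    rw [e1]
    rw [AlgEquiv.mul_apply] at hu
    field_simp at hu ⊢
    linear_combination -hu
  rw [e2]

end Slopes

end LPLinearSet

namespace LPLinearSet

/-! ### From projective equivalence to slopes and back. -/

section Bridge

variable {K : Type*} [Field K]

/-- The slopes `f(x) / x` of the points of the linear set of a polynomial `f`. -/
def polySlopes (f : K[X]) : Set K := {Y | ∃ x ≠ 0, f.eval x = Y * x}

theorem mk_mem_linearSet_iff (f : K[X]) (v : Fin 2 → K) (hv : v ≠ 0) :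
    Projectivization.mk K v hv ∈ linearSet f ↔ v 0 ≠ 0 ∧ v 1 / v 0 ∈ polySlopes f := by
  constructor
  · rintro ⟨x, hx, h⟩
    rw [Projectivization.mk_eq_mk_iff'] at h
    obtain ⟨a, ha⟩ := h
    have h0 : v 0 = a * x := by rw [← ha]; simp
    have h1 : v 1 = a * f.eval x := by rw [← ha]; simp
    have ha0 : a ≠ 0 := by
      rintro rfl
      exact hv (by rw [← ha, zero_smul])
    refine ⟨by rw [h0]; exact mul_ne_zero ha0 hx, x, hx, ?_⟩
    rw [h0, h1]
    field_simp
  · rintro ⟨h0, x, hx, h⟩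
    refine ⟨x, hx, ?_⟩
    rw [Projectivization.mk_eq_mk_iff']
    refine ⟨v 0 / x, ?_⟩
    funext i
    fin_cases i
    · simp [hx]
    · simp only [Fin.mk_one, Pi.smul_apply, Matrix.cons_val_one, Matrix.cons_val_zero, smul_eq_mul, h]
      field_simp

/-- A projectivity that maps one linear set onto another acts on the slopes as a Möbius map. -/
theorem exists_mobius_of_PGammaLEquiv {f g : K[X]}
    (h : PGammaLEquiv (linearSet f) (linearSet g)) :
    ∃ (τ : K ≃+* K) (a b c d : K), a * d - b * c ≠ 0 ∧ (b ≠ 0 → d / b ∉ polySlopes g) ∧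
      ∀ Y, Y ∈ polySlopes f ↔ a + b * τ Y ≠ 0 ∧ (c + d * τ Y) / (a + b * τ Y) ∈ polySlopes g := by
  obtain ⟨π, ⟨τ, F, hF, hπ⟩, himg⟩ := h
  have hmem : ∀ P, P ∈ linearSet f ↔ π P ∈ linearSet g := fun P => by
    rw [← himg, π.injective.mem_set_image]
  have hF0 : ∀ v, v ≠ 0 → F v ≠ 0 := fun v hv h0 => hv (hF.injective (by rw [h0, map_zero]))
  have key : ∀ v (hv : v ≠ 0), (v 0 ≠ 0 ∧ v 1 / v 0 ∈ polySlopes f) ↔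
      (F v 0 ≠ 0 ∧ F v 1 / F v 0 ∈ polySlopes g) := fun v hv => by
    rw [← mk_mem_linearSet_iff f v hv, ← mk_mem_linearSet_iff g _ (hF0 v hv), hmem, hπ,
      Projectivization.map_mk]
  have hlin : ∀ x y : K, F ![x, y] = τ x • F ![1, 0] + τ y • F ![0, 1] := fun x y => by
    have : ![x, y] = x • ![(1 : K), 0] + y • ![0, 1] := by simp
    rw [this, map_add, map_smulₛₗ, map_smulₛₗ]
    rfl
  have e0 : ![(1 : K), 0] ≠ 0 := fun h => one_ne_zero (congrFun h 0)
  have e1 : ![(0 : K), 1] ≠ 0 := fun h => one_ne_zero (congrFun h 1)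
  refine ⟨τ, F ![1, 0] 0, F ![0, 1] 0, F ![1, 0] 1, F ![0, 1] 1, ?_, ?_, ?_⟩
  · intro hdet
    set a := F ![1, 0] 0
    set b := F ![0, 1] 0
    set c := F ![1, 0] 1
    set d := F ![0, 1] 1
    have hz : ∀ x y : K, x * a + y * b = 0 → x * c + y * d = 0 → x = 0 ∧ y = 0 := by
      intro x y h1 h2
      have h3 : F ![τ.symm x, τ.symm y] = 0 := by
        rw [hlin]
        funext i
        fin_cases i
        · simpa using h1
        · simpa using h2
      have h4 : ![τ.symm x, τ.symm y] = 0 := by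
        by_contra h; exact hF0 _ h h3
      exact ⟨by simpa using congrFun h4 0, by simpa using congrFun h4 1⟩
    have h1 := hz d (-c) (by linear_combination hdet) (by ring)
    have h2 := hz b (-a) (by ring) (by linear_combination -hdet)
    have h3 := hz 1 0 (by rw [neg_eq_zero.mp h2.2]; ring) (by rw [neg_eq_zero.mp h1.2]; ring)
    exact one_ne_zero h3.1
  -- The point `⟨(0, 1)⟩` lies on no linear set of this kind, so its image, of slope `d / b`, lies
  -- outside the target.
  · intro hb hmem
    exact ((key _ e1).mpr ⟨hb, hmem⟩).1 (by simp)
  · intro Y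
    have hv : ![1, Y] ≠ 0 := pair_ne_zero one_ne_zero Y
    have := key _ hv
    rw [hlin] at this
    simpa [mul_comm (τ Y)] using this

theorem PGammaLEquiv_of_slopes [Finite K] {f g : K[X]} (τ : K ≃+* K) {r : K} (hr : r ≠ 0)
    (h : ∀ Y, Y ∈ polySlopes f ↔ τ (Y * r) ∈ polySlopes g) :
    PGammaLEquiv (linearSet f) (linearSet g) := by
  let F : (Fin 2 → K) →ₛₗ[(τ : K →+* K)] (Fin 2 → K) :=
    { toFun := fun v => ![τ (v 0), τ (v 1 * r)]
      map_add' := fun v w => by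
        funext i; fin_cases i <;> simp [add_mul]
      map_smul' := fun c v => by
        funext i; fin_cases i <;> simp [mul_assoc] }
  have hinj : Function.Injective F := by
    intro v w hvw
    have h0 : τ (v 0) = τ (w 0) := congrFun hvw 0
    have h1 : τ (v 1 * r) = τ (w 1 * r) := congrFun hvw 1
    funext i
    fin_cases i
    · exact τ.injective h0
    · exact mul_right_cancel₀ hr (τ.injective h1)
  have hbij : Function.Bijective F := Finite.injective_iff_bijective.mp hinj
  have hmapinj : Function.Injective (Projectivization.map F hinj) := by
    intro P Q hPQ
    induction P using Projectivization.ind with | h v hv =>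
    induction Q using Projectivization.ind with | h w hw =>
    rw [Projectivization.map_mk, Projectivization.map_mk, Projectivization.mk_eq_mk_iff'] at hPQ
    rw [Projectivization.mk_eq_mk_iff']
    obtain ⟨a, ha⟩ := hPQ
    refine ⟨τ.symm a, hinj ?_⟩
    rw [← ha, map_smulₛₗ]
    simp
  have : Finite (ℙ K (Fin 2 → K)) := inferInstance
  let π : Equiv.Perm (ℙ K (Fin 2 → K)) :=
    Equiv.ofBijective _ (Finite.injective_iff_bijective.mp hmapinj)
  have hπ : ∀ P, π P = Projectivization.map F hinj P := fun P => rfl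
  refine ⟨π, ⟨τ, F, hbij, hπ⟩, ?_⟩
  have hmem : ∀ P, P ∈ linearSet f ↔ π P ∈ linearSet g := by
    intro P
    induction P using Projectivization.ind with | h v hv =>
    rw [hπ, Projectivization.map_mk, mk_mem_linearSet_iff, mk_mem_linearSet_iff, h]
    have h0 : F v 0 = τ (v 0) := rfl
    have h1 : F v 1 = τ (v 1 * r) := rfl
    rw [h0, h1, ← map_div₀, div_mul_eq_mul_div]
    simp
  ext P
  constructor
  · rintro ⟨Q, hQ, rfl⟩
    exact (hmem Q).mp hQ
  · intro hP
    refine ⟨π.symm P, (hmem _).mpr (by simpa using hP), by simp⟩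

end Bridge

/-! ### The Frobenius generator, and norms as orbit products. -/

section Frobenius

theorem exists_frobenius (F K : Type*) [Field F] [Finite F] [Field K] [Finite K] [Algebra F K] : ∃ φ : K ≃ₐ[F] K, (∀ x, φ x = x ^ Nat.card F) ∧
    ∀ g, g ∈ Subgroup.zpowers φ := by
  have := Fintype.ofFinite F
  refine ⟨FiniteField.frobeniusAlgEquivOfAlgebraic F K, fun x => ?_, fun g => ?_⟩
  · rw [FiniteField.coe_frobeniusAlgEquivOfAlgebraic, Fintype.card_eq_nat_card]
  · obtain ⟨i, hi⟩ := (FiniteField.bijective_frobeniusAlgEquivOfAlgebraic_pow F K).2 g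
    exact ⟨i, by simpa using hi⟩

variable {F K : Type*} [Field F] [Field K] [Algebra F K]

theorem pow_apply_of_frobenius {φ : K ≃ₐ[F] K} (hφ : ∀ x, φ x = x ^ Nat.card F) (i : ℕ) (x : K) :
    (φ ^ i) x = x ^ Nat.card F ^ i := by
  induction i with
  | zero => simp
  | succ i ih => rw [pow_succ', AlgEquiv.mul_apply, ih, hφ, ← pow_mul, pow_succ]

variable [Finite K]

theorem natCard_algEquiv : Nat.card (K ≃ₐ[F] K) = Module.finrank F K :=
  IsGalois.card_aut_eq_finrank F K

theorem generator_pow {φ : K ≃ₐ[F] K} (hgen : ∀ g, g ∈ Subgroup.zpowers φ) {s : ℕ}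
    (hs : Nat.Coprime s (Module.finrank F K)) (g : K ≃ₐ[F] K) : g ∈ Subgroup.zpowers (φ ^ s) := by
  have hord : orderOf φ = Module.finrank F K := by
    rw [orderOf_eq_card_of_forall_mem_zpowers hgen, natCard_algEquiv]
  have : Subgroup.zpowers (φ ^ s) = ⊤ := by
    apply Subgroup.eq_top_of_card_eq
    rw [Nat.card_zpowers, Nat.Coprime.orderOf_pow, hord, natCard_algEquiv]
    rw [hord]; exact hs.symm
  rw [this]
  exact Subgroup.mem_top g

theorem polySlopes_lpPoly [DecidableEq (K ≃ₐ[F] K)] {φ : K ≃ₐ[F] K}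
    (hφ : ∀ x, φ x = x ^ Nat.card F) (s : ℕ) (θ : K) :
    polySlopes (lpPoly (Nat.card F) (Module.finrank F K) s θ) = slopes (lpCoeff (φ ^ s) 1 θ) := by
  ext Y
  refine exists_congr fun x => and_congr_right fun _ => ?_
  have hpos : 0 < Module.finrank F K := Module.finrank_pos
  have hinv : (φ ^ s)⁻¹ = φ ^ (s * (Module.finrank F K - 1)) := by
    rw [inv_eq_iff_mul_eq_one, ← pow_add]
    have : s + s * (Module.finrank F K - 1) = Module.finrank F K * s := by
      obtain ⟨k, hk⟩ := Nat.exists_eq_succ_of_ne_zero hpos.ne'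
      rw [hk]; simp; ring
    rw [this, pow_mul, ← natCard_algEquiv, pow_card_eq_one', one_pow]
  rw [skewEval_lpCoeff, hinv, pow_apply_of_frobenius hφ, pow_apply_of_frobenius hφ]
  simp [lpPoly]

/-- This makes the orbit product along `(φ ^ s)²` independent of `s`, so the norm condition does not
involve `s`. -/
theorem zpowers_pow_two_mul {φ : K ≃ₐ[F] K} (hgen : ∀ g, g ∈ Subgroup.zpowers φ) {s : ℕ}
    (hs : Nat.Coprime s (Module.finrank F K)) :
    Subgroup.zpowers (φ ^ s * φ ^ s) = Subgroup.zpowers (φ * φ) := by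
  have key : ∀ ρ κ : K ≃ₐ[F] K, κ ∈ Subgroup.zpowers ρ →
      κ * κ ∈ Subgroup.zpowers (ρ * ρ) := by
    rintro ρ κ ⟨i, rfl⟩
    exact ⟨i, by simp only; rw [(Commute.refl ρ).mul_zpow]⟩
  apply le_antisymm
  · rw [Subgroup.zpowers_le]
    exact key _ _ (hgen _)
  · rw [Subgroup.zpowers_le]
    exact key _ _ (generator_pow hgen hs φ)

theorem orbitProd_congr {ρ κ : K ≃ₐ[F] K} (h : Subgroup.zpowers ρ = Subgroup.zpowers κ) (x : K) :
    orbitProd ρ x = orbitProd κ x := by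
  unfold orbitProd
  congr!

theorem algebraMap_norm_eq_orbitProd_of_odd {φ : K ≃ₐ[F] K}
    (hgen : ∀ g, g ∈ Subgroup.zpowers φ) (hodd : ¬ 2 ∣ Module.finrank F K) (x : K) :
    algebraMap F K (Algebra.norm F x) = orbitProd (φ * φ) x := by
  rw [Algebra.norm_eq_prod_automorphisms, orbitProd_eq_prod_of_generator]
  have h2 : Nat.Coprime 2 (Module.finrank F K) :=
    (Nat.Prime.coprime_iff_not_dvd Nat.prime_two).mpr hodd
  intro g
  rw [← sq]
  exact generator_pow hgen h2 g

theorem coe_norm_subfieldOfDegree_two [Finite F] {φ : K ≃ₐ[F] K} (hφ : ∀ x, φ x = x ^ Nat.card F)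
    (x : K) :
    algebraMap (subfieldOfDegree F K 2) K (Algebra.norm (subfieldOfDegree F K 2) x) =
      orbitProd (φ * φ) x := by
  classical
  have hE : subfieldOfDegree F K 2 = IntermediateField.fixedField (Subgroup.zpowers (φ * φ)) := by
    ext y
    have h1 : y ∈ subfieldOfDegree F K 2 ↔ (φ * φ) y = y := by
      rw [← sq, pow_apply_of_frobenius hφ]
      rfl
    rw [h1, IntermediateField.mem_fixedField_iff]
    constructor
    · rintro h _ ⟨i, rfl⟩
      exact MulAction.mem_stabilizer_iff.mp
        (zpow_mem (MulAction.mem_stabilizer_iff.mpr h : φ * φ ∈ MulAction.stabilizer _ y) i)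
    · intro h
      exact h _ (Subgroup.mem_zpowers _)
  have hfix : (subfieldOfDegree F K 2).fixingSubgroup = Subgroup.zpowers (φ * φ) := by
    rw [hE, IntermediateField.fixingSubgroup_fixedField]
  rw [Algebra.norm_eq_prod_automorphisms, orbitProd]
  refine (Fintype.prod_equiv ((MulEquiv.subgroupCongr hfix).symm.trans
    (IntermediateField.fixingSubgroupEquiv _)).toEquiv _ _ fun g => rfl).symm

theorem map_orbitProd (ρ : K ≃ₐ[F] K) (τ : K ≃+* K) (h : ∀ x, τ (ρ x) = ρ (τ x)) (x : K) :
    τ (orbitProd ρ x) = orbitProd ρ (τ x) := by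
  have key : ∀ (i : ℕ) x, τ ((ρ ^ i) x) = (ρ ^ i) (τ x) := fun i => by
    induction i with
    | zero => simp
    | succ i ih => intro x; rw [pow_succ', AlgEquiv.mul_apply, h, ih, AlgEquiv.mul_apply]
  rw [orbitProd_eq_prod_range, orbitProd_eq_prod_range, map_prod]
  exact Finset.prod_congr rfl fun i _ => key i x

end Frobenius

end LPLinearSet

/-! ### The classification. -/

section LPClassification

open LPLinearSet

theorem theorem3p1 (F K : Type*) [Field F] [Finite F] [Field K] [Finite K] [Algebra F K]
    (q n s t : ℕ) (hq : Nat.card F = q) (hn : Module.finrank F K = n) (hn4 : 4 ≤ n)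
    (hs : 1 ≤ s) (hs' : 2 * s < n) (hsn : Nat.Coprime s n)
    (ht : 1 ≤ t) (ht' : 2 * t < n) (htn : Nat.Coprime t n)
    (θ δ : K) (hθ : θ ≠ 0) (hδ : δ ≠ 0)
    (hNθ : Algebra.norm F θ ≠ 1) (hNδ : Algebra.norm F δ ≠ 1) :
    LPLinearSet.PGammaLEquiv
        (LPLinearSet.linearSet (LPLinearSet.lpPoly q n s θ))
        (LPLinearSet.linearSet (LPLinearSet.lpPoly q n t δ)) ↔
      s = t ∧
        ((¬ 2 ∣ n ∧ ∃ τ : K ≃+* K,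
            Algebra.norm F θ ∈
              ({Algebra.norm F (τ δ), Algebra.norm F (1 / τ δ)} : Set F)) ∨
         (2 ∣ n ∧ ∃ τ : K ≃+* K,
            Algebra.norm (LPLinearSet.subfieldOfDegree F K 2) θ ∈
              ({Algebra.norm (LPLinearSet.subfieldOfDegree F K 2) (τ δ),
                Algebra.norm (LPLinearSet.subfieldOfDegree F K 2) (1 / τ δ)} :
                Set (LPLinearSet.subfieldOfDegree F K 2)))) := by

  classical
  subst hq hn
  obtain ⟨φ, hφ, hgen⟩ := exists_frobenius F K
  have hord : orderOf φ = Module.finrank F K := by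
    rw [orderOf_eq_card_of_forall_mem_zpowers hgen, natCard_algEquiv]
  have hA : ∀ {i : ℕ}, Nat.Coprime i (Module.finrank F K) → ∀ x,
      orbitProd (φ ^ i * φ ^ i) x = orbitProd (φ * φ) x := fun hi x =>
    orbitProd_congr (zpowers_pow_two_mul hgen hi) x
  have hcommφ : ∀ (τ : K ≃+* K) (i : ℕ) x, τ ((φ ^ i) x) = (φ ^ i) (τ x) := fun τ i x => by
    rw [pow_apply_of_frobenius hφ, pow_apply_of_frobenius hφ, map_pow]
  have hτA : ∀ (τ : K ≃+* K) x, τ (orbitProd (φ * φ) x) = orbitProd (φ * φ) (τ x) := fun τ x =>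
    map_orbitProd _ τ (fun x => by rw [← sq]; exact hcommφ τ 2 x) x
  have hnorm : ((¬ 2 ∣ Module.finrank F K ∧ ∃ τ : K ≃+* K,
            Algebra.norm F θ ∈
              ({Algebra.norm F (τ δ), Algebra.norm F (1 / τ δ)} : Set F)) ∨
         (2 ∣ Module.finrank F K ∧ ∃ τ : K ≃+* K,
            Algebra.norm (subfieldOfDegree F K 2) θ ∈
              ({Algebra.norm (subfieldOfDegree F K 2) (τ δ),
                Algebra.norm (subfieldOfDegree F K 2) (1 / τ δ)} :
                Set (subfieldOfDegree F K 2)))) ↔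
      ∃ τ : K ≃+* K, orbitProd (φ * φ) θ = orbitProd (φ * φ) (τ δ) ∨
        orbitProd (φ * φ) θ = orbitProd (φ * φ) (1 / τ δ) := by
    by_cases h2 : 2 ∣ Module.finrank F K
    · simp only [h2, not_true_eq_false, false_and, true_and, false_or, Set.mem_insert_iff,
        Set.mem_singleton_iff, ← coe_norm_subfieldOfDegree_two hφ,
        (algebraMap (subfieldOfDegree F K 2) K).injective.eq_iff]
    · simp only [h2, not_false_eq_true, false_and, true_and, or_false, Set.mem_insert_iff,
        Set.mem_singleton_iff, ← algebraMap_norm_eq_orbitProd_of_odd hgen h2,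
        (algebraMap F K).injective.eq_iff]
  rw [hnorm]
  have hf := polySlopes_lpPoly (F := F) (K := K) hφ s θ
  have hg := polySlopes_lpPoly (F := F) (K := K) hφ t δ
  have hcard : 4 ≤ Nat.card (K ≃ₐ[F] K) := by rwa [natCard_algEquiv]
  constructor
  · intro h
    obtain ⟨τ, a, b, c, d, hdet, hb, hU⟩ := exists_mobius_of_PGammaLEquiv h
    rw [hf, hg] at hU
    rw [hg] at hb
    -- Replacing `θ` by `τ θ` absorbs the field automorphism and leaves a purely linear equivalence.
    have hU' : ∀ u, u ∈ slopes (lpCoeff (φ ^ s) 1 (τ θ)) ↔ a + b * u ≠ 0 ∧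
        (c + d * u) / (a + b * u) ∈ slopes (lpCoeff (φ ^ t) 1 δ) := fun u => by
      obtain ⟨Y, rfl⟩ := τ.surjective u
      rw [mem_slopes_lpCoeff_map _ τ (hcommφ τ s), hU]
    have hN : ∏ g : K ≃ₐ[F] K, g δ ≠ 1 := by
      rw [← Algebra.norm_eq_prod_automorphisms]
      simpa using hNδ
    have hst : φ ^ s ≠ (φ ^ t)⁻¹ := by
      rw [Ne, ← mul_eq_one_iff_eq_inv, ← pow_add]
      exact pow_ne_one_of_generator hgen (by omega) (by rw [natCard_algEquiv]; omega)
    have h4 : Nat.card (K ≃ₐ[F] K) = 4 → φ ^ s = φ ^ t := fun h4 => by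
      rw [natCard_algEquiv] at h4
      congr 1
      omega
    obtain ⟨hpow, hor⟩ := orbitProd_eq_or_of_mobius (generator_pow hgen hsn)
      (generator_pow hgen htn) hcard h4 hst (by simpa using hθ) hδ hN hdet hb hU'
    refine ⟨pow_injOn_Iio_orderOf (by rw [hord]; simp; omega) (by rw [hord]; simp; omega) hpow, ?_⟩
    rw [hA hsn, hA hsn] at hor
    rcases hor with hor | hor
    · refine ⟨τ.symm, Or.inl ?_⟩
      rw [← hτA, ← hor, ← hτA, RingEquiv.symm_apply_apply]
    -- The conjugation by `φ ^ s` in the inverse alternative is itself a field automorphism, so it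
    -- is merged into the witness.
    · refine ⟨(φ ^ s : K ≃ₐ[F] K).toRingEquiv.trans τ.symm, Or.inr ?_⟩
      rw [one_div, orbitProd_inv, ← hτA]
      apply eq_inv_of_mul_eq_one_left
      apply τ.injective
      rw [map_mul, hτA, map_one, ← hor]
      congr 1
      simp
  · rintro ⟨rfl, τ, h | h⟩
    · rw [← hA hsn, ← hA hsn (τ δ)] at h
      obtain ⟨r, hr, hY⟩ := exists_smul_slopes_of_orbitProd_eq hθ h
      refine PGammaLEquiv_of_slopes τ.symm hr fun Y => ?_
      rw [hf, hg, hY, ← mem_slopes_lpCoeff_map _ τ (hcommφ τ s) δ, RingEquiv.apply_symm_apply]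
    · rw [← hA hsn, ← hA hsn (1 / τ δ)] at h
      obtain ⟨r, hr, hY⟩ := exists_smul_slopes_of_orbitProd_eq hθ h
      have hτδ : τ δ ≠ 0 := by simpa using hδ
      -- Twisting `τ` by `(φ ^ s)⁻¹` makes the leading coefficient `φ ^ s (κ δ)` of the adjoint
      -- equal to `τ δ`; dividing by it leaves the parameter `1 / τ δ`.
      let κ : K ≃+* K := τ.trans ((φ ^ s)⁻¹ : K ≃ₐ[F] K).toRingEquiv
      have hκ : (φ ^ s) (κ δ) = τ δ := by
        change ((φ ^ s) * (φ ^ s)⁻¹ : K ≃ₐ[F] K) (τ δ) = τ δ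
        rw [mul_inv_cancel, AlgEquiv.one_apply]
      refine PGammaLEquiv_of_slopes κ.symm (mul_ne_zero hr hτδ) fun Y => ?_
      rw [hf, hg, hY, ← mem_slopes_lpCoeff_map _ κ (hcommφ κ s) δ, RingEquiv.apply_symm_apply,
        slopes_lpCoeff_adjoint _ (κ δ), hκ, mem_slopes_lpCoeff_const_mul _ hτδ, mul_one,
        mul_one_div_cancel hτδ]
      ring_nf

end LPClassification
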